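/- All fields and rings have characteristic $0$; a difference ring $(R,\sigma)$ is a commutative ring with an automorphism, and $\mathrm{const}(R,\sigma)=\{c\in R\mid\sigma(c)=c\}$. **Setting.** Let $(\mathbb F,\sigma)$ be a difference field and let $(\mathbb F(x),\sigma)$ be a $\Pi\Sigma$-field extension of it: $x$ is transcendental over $\mathbb F$, $\mathrm{const}(\mathbb F(x),\sigma)=\mathrm{const}(\mathbb F,\sigma)=:\mathbb K$, and $\sigma(x)/x\in\mathbb F^*$ or $\sigma(x)-x\in\mathbb F$. The *period* of $h\in\mathbb F(x)^*$ is the smallest $n>0$ with $\sigma^n(h)/h\in\mathbb F$, and $0$ if there is none. For $d\in\mathbb N$, an element of $\mathbb F(x)^*$ has *$x$-degree $\le d$* if every irreducible polynomial of period $0$ occurring in its numerator or denominator has degree $\le d$. Irreducible $f,g\in\mathbb F[x]$ are *$\sigma$-equivalent* if $\sigma^k(f)/g\in\mathbb F$ for some $k\in\mathbb Z$, and *$\sigma$-coprime* otherwise. An *$R\Pi\Sigma$-extension* $(\mathbb E,\sigma)$ of a difference ring $(\mathbb A,\sigma)$ is a difference ring extension $\mathbb E=\mathbb A\langle t_1\rangle\cdots\langle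 t_e\rangle$ with $\mathrm{const}(\mathbb E,\sigma)=\mathrm{const}(\mathbb A,\sigma)$ such that, with $\mathbb A_i=\mathbb A\langle t_1\rangle\cdots\langle t_i\rangle$, each $t_i$ is one of the following: an $R$-monomial ($\mathbb A_i=\mathbb A_{i-1}[t_i]$ subject to $t_i^\nu=1$ with $\nu>1$, where $\sigma(t_i)/t_i\in\mathbb A_{i-1}^*$ is a primitive $\nu$-th root of unity), a $\Pi$-monomial ($\mathbb A_i=\mathbb A_{i-1}[t_i,t_i^{-1}]$ is a Laurent polynomial ring and $\sigma(t_i)/t_i\in\mathbb A_{i-1}^*$), or a $\Sigma$-monomial ($\mathbb A_i=\mathbb A_{i-1}[t_i]$ is a polynomial ring and $\sigma(t_i)-t_i\in\mathbb A_{i-1}$). It is a *$\Sigma$-extension* if all $t_i$ are $\Sigma$-monomials. It is *simple* if for every $R$- or $\Pi$-monomial $\sigma(t_i)/t_i=u\,t_1^{m_1}\cdots t_{i-1}^{m_{i-1}}$ with $u\in\mathbb A^*$, $m_j\in\mathbb Z$ and $m_j=0$ whenever $t_j$ is a $\Sigma$-monomial, where for $R$-monomials $u$ is moreover a root of unity and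 $m_j=0$ whenever $t_j$ is a $\Pi$-monomial. If $\mathbb A=\mathbb F(x)$, every $f\in\mathbb E$ is uniquely $f=\sum_{\mathbf n}f_{\mathbf n}\mathbf t^{\mathbf n}$ with $f_{\mathbf n}\in\mathbb F(x)$, over the reduced exponents $\mathbf n\in\mathbb Z^e$ ($0\le n_i<\nu$ for an $R$-monomial of order $\nu$, $n_i\ge0$ for a $\Sigma$-monomial). Then $\mathrm{den}(f)\in\mathbb F[x]$ is the monic least common multiple of the denominators of the $f_{\mathbf n}$, $\mathbb F[x]\langle t_1\rangle\cdots\langle t_e\rangle$ is the set of $f$ with all $f_{\mathbf n}\in\mathbb F[x]$, and for such $f$, $\deg_x f$ is the maximum of the $\deg f_{\mathbf n}$ ($-\infty$ for $f=0$). A simple $R\Pi\Sigma$-extension of $(\mathbb F(x),\sigma)$ has *$x$-degree $\le d$* if for each $\Pi$-monomial the factor $u\in\mathbb F(x)^*$ above has $x$-degree $\le d$, and for each $\Sigma$-monomial $\mathrm{den}(\sigma(t_i)-t_i)$ has $x$-degree $\le d$. A *$(d,x)$-set* is a finite set of monic irreducible polynomials in $\mathbb F[x]$ of degree $>d$ and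 period $0$ that are pairwise $\sigma$-coprime. It is *$(d,b)$-complete*, for $b\in\mathbb F[x]\setminus\{0\}$, if every irreducible factor of $b$ of period $0$ and degree $>d$ is $\sigma$-equivalent to one of its elements. **Statement.** Let $(\mathbb E,\sigma)$, $\mathbb E=\mathbb F(x)\langle t_1\rangle\cdots\langle t_e\rangle$, be a simple $R\Pi\Sigma$-extension of $(\mathbb F(x),\sigma)$ with $x$-degree $\le d$. Let $f_1,\dots,f_m\in\mathbb E$ and let $Q=\{q_1,\dots,q_r\}$ (with distinct $q_j$) be a $(d,x)$-set that is $(d,\mathrm{den}(f_i))$-complete for all $1\le i\le m$. Let $f'_i,g_i\in\mathbb E$ be such that $\sigma(g_i)-g_i+f'_i=f_i$ and $$f'_i=\frac{p_{i,1}}{q_1^{n_{i,1}}}+\dots+\frac{p_{i,r}}{q_r^{n_{i,r}}}+\frac{p'_i}{q'_i},$$ where $n_{i,j}\ge1$, $q'_i\in\mathbb F[x]\setminus\{0\}$ has $x$-degree $\le d$, $p'_i,p_{i,j}\in\mathbb F[x]\langle t_1\rangle\cdots\langle t_e\rangle$ and $\deg_x(p_{i,j})<n_{i,j}\deg(q_j)$.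 For $1\le j\le r$ let $\mu_j=\max(n_{1,j},\dots,n_{m,j})$ and $$V_j=\Big\{\mathbf c\in\mathbb K^m\ \Big|\ \sum_{i=1}^m c_i\,q_j^{\mu_j-n_{i,j}}p_{i,j}=0\Big\}.$$ Then for every $\mathbf c=(c_1,\dots,c_m)\in\mathbb K^m$ the following holds. 1. There is an $h\in\mathbb E$ with $$\sigma(h)-h=c_1f_1+\dots+c_mf_m\qquad(\ast)$$ if and only if there is a $g'\in\mathbb E$ with $$\sigma(g')-g'=c_1\frac{p'_1}{q'_1}+\dots+c_m\frac{p'_m}{q'_m}\qquad(\ast\ast)$$ and $\mathbf c\in V_j$ for all $1\le j\le r$. If this is the case, then for every $g'\in\mathbb E$ with $(\ast\ast)$ the polynomial $\mathrm{den}(g')$ has $x$-degree $\le d$, and $h=g'+\sum_{i=1}^mc_ig_i$ is a solution of $(\ast)$. 2. If $\mathbf c\in V_j$ for all $1\le j\le r$ but there is no $g'\in\mathbb E$ with $(\ast\ast)$, then there is a $\Sigma$-extension $(\mathbb E[t],\sigma)$ of $(\mathbb E,\sigma)$, with $\mathbb E[t]$ the polynomial ring and $\sigma(t)-t=c_1\frac{p'_1}{q'_1}+\dots+c_m\frac{p'_m}{q'_m}$,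 such that $(\mathbb E[t],\sigma)$ is a simple $R\Pi\Sigma$-extension of $(\mathbb F(x),\sigma)$ with $x$-degree $\le d$, and $h=t+\sum_{i=1}^mc_ig_i$ satisfies $(\ast)$ in $\mathbb E[t]$. -/

import Mathlib

open Polynomial

noncomputable section

namespace RefinedTelescoping

/-! Difference rings: a commutative ring with an automorphism `σ : RingAut R`. -/

/-- The subring of constants `const(R, σ) = {c | σ c = c}`. -/
def constants {R : Type*} [CommRing R] (σ : RingAut R) : Subring R :=
  RingHom.eqLocus (σ : R →+* R) (RingHom.id R)

/-- The annihilator space `Ann_K(f₁, …, f_m) = {c ∈ K^m | c₁ f₁ + ⋯ + c_m f_m = 0}`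
with `K = const(R, σ)`. -/
def Ann {R : Type*} [CommRing R] (σ : RingAut R) {m : ℕ} (f : Fin m → R) :
    Submodule (constants σ) (Fin m → constants σ) :=
  LinearMap.ker (Fintype.linearCombination (constants σ) f)

theorem mem_Ann {R : Type*} [CommRing R] (σ : RingAut R) {m : ℕ} (f : Fin m → R)
    (c : Fin m → constants σ) : c ∈ Ann σ f ↔ ∑ i, (c i : R) * f i = 0 := by
  simp [Ann, Fintype.linearCombination_apply, Subring.smul_def]

section Base

variable {F : Type*} [Field F]

/-- `(F(x), σ)` is a ΠΣ-field extension of `(F, σF)` by the single monomial `x`: `σ` extends `σF`,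
the constants are unchanged, and `σ(x)/x ∈ F \ {0}` or `σ(x) - x ∈ F`. -/
structure IsPiSigmaFieldExt (σF : RingAut F) (σ : RingAut (RatFunc F)) : Prop where
  extends_base : ∀ a : F, σ (RatFunc.C a) = RatFunc.C (σF a)
  constants_eq : ∀ y : RatFunc F, σ y = y → ∃ a : F, σF a = a ∧ RatFunc.C a = y
  monomial : (∃ a : F, a ≠ 0 ∧ σ RatFunc.X / RatFunc.X = RatFunc.C a) ∨
    ∃ b : F, σ RatFunc.X - RatFunc.X = RatFunc.C b

/-- The element of `F(x)` given by a polynomial. -/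
abbrev toRat (p : F[X]) : RatFunc F := algebraMap F[X] (RatFunc F) p

/-- `h` lies in `F`. -/
def InBase (h : RatFunc F) : Prop := ∃ a : F, RatFunc.C a = h

/-- The period of `h`: the least `n > 0` with `σ^n(h)/h ∈ F`, and `0` if there is none. -/
def period (σ : RingAut (RatFunc F)) (h : RatFunc F) : ℕ :=
  sInf {n : ℕ | 0 < n ∧ InBase ((σ ^ n) h / h)}

/-- A nonzero `f ∈ F(x)` has `x`-degree `≤ d`: every irreducible polynomial of period `0` that
occurs in the factorization of `f` (in the numerator or in the denominator) has degree `≤ d`. -/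
def XDegreeLE (σ : RingAut (RatFunc F)) (d : ℕ) (f : RatFunc F) : Prop :=
  ∀ p : F[X], Irreducible p → (p ∣ f.num ∨ p ∣ f.denom) → period σ (toRat p) = 0 →
    p.natDegree ≤ d

/-- `σ`-equivalence of (irreducible) polynomials; `σ`-coprime is the negation. -/
def SigmaEquiv (σ : RingAut (RatFunc F)) (f g : F[X]) : Prop :=
  ∃ k : ℤ, InBase ((σ ^ k) (toRat f) / toRat g)

/-- `(d, x)`-sets. -/
structure IsDXSet (σ : RingAut (RatFunc F)) (d : ℕ) (Q : Set F[X]) : Prop where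
  finite : Q.Finite
  monic : ∀ q ∈ Q, q.Monic
  irreducible : ∀ q ∈ Q, Irreducible q
  lt_natDegree : ∀ q ∈ Q, d < q.natDegree
  period_eq_zero : ∀ q ∈ Q, period σ (toRat q) = 0
  coprime : ∀ q ∈ Q, ∀ q' ∈ Q, q ≠ q' → ¬ SigmaEquiv σ q q'

/-- `Q` is `(d, f)`-complete: every irreducible factor of `f` of period `0` and of degree `> d` is
`σ`-equivalent to an element of the `(d, x)`-set `Q`. -/
structure IsComplete (σ : RingAut (RatFunc F)) (d : ℕ) (f : F[X]) (Q : Set F[X]) : Prop where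
  isDXSet : IsDXSet σ d Q
  complete : ∀ h : F[X], Irreducible h → h ∣ f → d < h.natDegree → period σ (toRat h) = 0 →
    ∃ q ∈ Q, SigmaEquiv σ q h

end Base

/-- The three kinds of monomials: R-monomials of order `ν`, Π-monomials, Σ-monomials. -/
inductive MonomialKind where
  | root (ν : ℕ)
  | pi
  | sigma

section Tower

variable {A E : Type*} [CommRing A] [CommRing E] [Algebra A E] {e : ℕ}

/-- The ring `A⟨t₁⟩…⟨tᵢ⟩` generated over `A` by the first `i` monomials, and by the inverses of the
Π-monomials among them. -/
def level (A : Type*) {E : Type*} [CommRing A] [CommRing E] [Algebra A E] {e : ℕ}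
    (kind : Fin e → MonomialKind) (t : Fin e → E) (i : ℕ) : Subalgebra A E :=
  Algebra.adjoin A {y | ∃ j : Fin e, (j : ℕ) < i ∧
    (y = t j ∨ (kind j = .pi ∧ y = Ring.inverse (t j)))}

/-- `t` is an R-, Π- or Σ-monomial over the subring `B`, up to the condition on the constants:
`B[t] ≅ B[X]/(X^ν - 1)` with `σ(t)/t` a primitive `ν`-th root of unity in `B`;
`B[t, t⁻¹]` is a Laurent polynomial ring (`t` is invertible and transcendental over `B`) with
`σ(t)/t` a unit of `B`; or `B[t]` is a polynomial ring with `σ(t) - t ∈ B`. -/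
def IsMonomial (σ : RingAut E) (B : Subalgebra A E) (t : E) : MonomialKind → Prop
  | .root ν => 1 < ν ∧ RingHom.ker (aeval t : B[X] →ₐ[B] E) = Ideal.span {X ^ ν - 1} ∧
      ∃ α : Bˣ, IsPrimitiveRoot α ν ∧ σ t = ((α : B) : E) * t
  | .pi => IsUnit t ∧ Transcendental B t ∧ ∃ α : Bˣ, σ t = ((α : B) : E) * t
  | .sigma => Transcendental B t ∧ σ t - t ∈ B

/-- `(E, σE)` with `E = A⟨t₁⟩…⟨t_e⟩` is an RΠΣ-extension of the difference ring `(A, σA)`. -/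
structure IsRPiSigmaExt (σA : RingAut A) (σE : RingAut E) (kind : Fin e → MonomialKind)
    (t : Fin e → E) : Prop where
  injective : Function.Injective (algebraMap A E)
  extends_base : ∀ a : A, σE (algebraMap A E a) = algebraMap A E (σA a)
  monomial : ∀ i : Fin e, IsMonomial σE (level A kind t i) (t i) (kind i)
  generates : level A kind t e = ⊤
  constants_eq : ∀ y : E, σE y = y → ∃ a : A, σA a = a ∧ algebraMap A E a = y

/-- The integer power `t^n`; the inverse is that of the ring `E`, used for units only. -/
def ipow (t : E) (n : ℤ) : E :=
  if 0 ≤ n then t ^ n.toNat else Ring.inverse t ^ (-n).toNat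

/-- The power product `t₁^{n₁} ⋯ t_e^{n_e}`. -/
def powerProduct (t : Fin e → E) (n : Fin e → ℤ) : E := ∏ i, ipow (t i) (n i)

/-- Reduced exponent vectors: `0 ≤ nᵢ < ν` for an R-monomial of order `ν`, `nᵢ ∈ ℤ` for a
Π-monomial and `0 ≤ nᵢ` for a Σ-monomial. -/
def IsReduced (kind : Fin e → MonomialKind) (n : Fin e → ℤ) : Prop :=
  ∀ i, match kind i with
    | .root ν => 0 ≤ n i ∧ n i < ν
    | .pi => True
    | .sigma => 0 ≤ n i

/-- `φ` lists the coefficients of `f` with respect to the reduced power products. -/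
structure IsExpansion (kind : Fin e → MonomialKind) (t : Fin e → E) (f : E)
    (φ : (Fin e → ℤ) →₀ A) : Prop where
  reduced : ∀ n ∈ φ.support, IsReduced kind n
  eq_sum : f = φ.sum fun n a => a • powerProduct t n

open Classical in
/-- The coefficients `(fₙ)ₙ` of `f = ∑ₙ fₙ tⁿ` with respect to the reduced power products (these
form an `A`-basis of an RΠΣ-extension with monomials `t`). -/
def coeffs (A : Type*) {E : Type*} [CommRing A] [CommRing E] [Algebra A E] {e : ℕ}
    (kind : Fin e → MonomialKind) (t : Fin e → E) (f : E) : (Fin e → ℤ) →₀ A :=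
  if h : ∃ φ : (Fin e → ℤ) →₀ A, IsExpansion kind t f φ then h.choose else 0

/-- `(E, σE)` is simple over `A`: for every R- or Π-monomial,
`σ(tᵢ)/tᵢ = u t₁^{m₁} ⋯ t_{i-1}^{m_{i-1}}` with `u ∈ A^*` and `m_j = 0` if `t_j` is a Σ-monomial;
for an R-monomial `u` is moreover a root of unity and `m_j = 0` if `t_j` is a Π- or Σ-monomial. -/
def IsSimpleExt (A : Type*) {E : Type*} [CommRing A] [CommRing E] [Algebra A E] {e : ℕ}
    (σE : RingAut E) (kind : Fin e → MonomialKind) (t : Fin e → E) : Prop :=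
  ∀ i, match kind i with
    | .root _ => ∃ (u : Aˣ) (m : Fin e → ℤ), (∃ k : ℕ, 0 < k ∧ u ^ k = 1) ∧
        (∀ j, i ≤ j ∨ kind j = .pi ∨ kind j = .sigma → m j = 0) ∧
        σE (t i) = ((u : A) • powerProduct t m) * t i
    | .pi => ∃ (u : Aˣ) (m : Fin e → ℤ),
        (∀ j, i ≤ j ∨ kind j = .sigma → m j = 0) ∧
        σE (t i) = ((u : A) • powerProduct t m) * t i
    | .sigma => True

end Tower

section XDegree

variable {F : Type*} [Field F] {E : Type*} [CommRing E] [Algebra (RatFunc F) E] {e : ℕ}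

open Classical in
/-- The denominator `den(f)`: the monic least common multiple of the denominators of the
coefficients of `f`. -/
def den (F : Type*) [Field F] {E : Type*} [CommRing E] [Algebra (RatFunc F) E] {e : ℕ}
    (kind : Fin e → MonomialKind) (t : Fin e → E) (f : E) : F[X] :=
  letI : NormalizedGCDMonoid F[X] := UniqueFactorizationMonoid.toNormalizedGCDMonoid F[X]
  (coeffs (RatFunc F) kind t f).support.lcm fun n => (coeffs (RatFunc F) kind t f n).denom

/-- `f ∈ F[x]⟨t₁⟩…⟨t_e⟩`: all coefficients of `f` are polynomials in `x`. -/
def IsXPoly (F : Type*) [Field F] {E : Type*} [CommRing E] [Algebra (RatFunc F) E] {e : ℕ}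
    (kind : Fin e → MonomialKind) (t : Fin e → E) (f : E) : Prop :=
  ∀ n, ∃ p : F[X], coeffs (RatFunc F) kind t f n = toRat p

/-- The degree in `x` of `f ∈ F[x]⟨t₁⟩…⟨t_e⟩` (with value `⊥` at `f = 0`). -/
def degX (F : Type*) [Field F] {E : Type*} [CommRing E] [Algebra (RatFunc F) E] {e : ℕ}
    (kind : Fin e → MonomialKind) (t : Fin e → E) (f : E) : WithBot ℕ :=
  (coeffs (RatFunc F) kind t f).support.sup fun n => (coeffs (RatFunc F) kind t f n).num.degree

/-- The (simple) extension `(E, σE)` of `(F(x), σ)` has `x`-degree `≤ d`. -/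
def ExtXDegreeLE (σ : RingAut (RatFunc F)) (σE : RingAut E) (kind : Fin e → MonomialKind)
    (t : Fin e → E) (d : ℕ) : Prop :=
  ∀ i, match kind i with
    | .root _ => True
    | .pi => ∃ (u : RatFunc F) (m : Fin e → ℤ), u ≠ 0 ∧ XDegreeLE σ d u ∧
        (∀ j, i ≤ j ∨ kind j = .sigma → m j = 0) ∧
        σE (t i) = (u • powerProduct t m) * t i
    | .sigma => XDegreeLE σ d (toRat (den F kind t (σE (t i) - t i)))

/-- `(E, σE)` with `E = F(x)⟨t₁⟩…⟨t_e⟩` is a simple RΠΣ-extension of `(F(x), σ)` with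
`x`-degree `≤ d`. -/
structure IsSimpleRPiSigmaExtXDegreeLE (σ : RingAut (RatFunc F)) (σE : RingAut E)
    (kind : Fin e → MonomialKind) (t : Fin e → E) (d : ℕ) : Prop where
  isExt : IsRPiSigmaExt σ σE kind t
  simple : IsSimpleExt (RatFunc F) σE kind t
  xDegreeLE : ExtXDegreeLE σ σE kind t d

/-- The element `p/q` of `E`, for `p ∈ E` and `q ∈ F[x]`. -/
def quot (p : E) (q : F[X]) : E := (toRat q)⁻¹ • p

/-- The `σ`-reduced form `f' = p₁/q₁^{n₁} + ⋯ + p_r/q_r^{n_r} + p/q`. -/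
structure IsReducedForm (σ : RingAut (RatFunc F)) (kind : Fin e → MonomialKind) (t : Fin e → E)
    (d : ℕ) {r : ℕ} (Q : Fin r → F[X]) (f' : E) (P : Fin r → E) (n : Fin r → ℕ)
    (p : E) (q : F[X]) : Prop where
  eq_sum : f' = (∑ j, quot (P j) (Q j ^ n j)) + quot p q
  one_le : ∀ j, 1 ≤ n j
  ne_zero : q ≠ 0
  xDegreeLE : XDegreeLE σ d (toRat q)
  isXPoly : IsXPoly F kind t p
  isXPoly_bad : ∀ j, IsXPoly F kind t (P j)
  degX_lt : ∀ j, degX F kind t (P j) < (((Q j).natDegree * n j : ℕ) : WithBot ℕ)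

/-- The space `V_j = Ann_K(q_j^{μ_j - n_{1,j}} p_{1,j}, …, q_j^{μ_j - n_{m,j}} p_{m,j})` with
`μ_j = max(n_{1,j}, …, n_{m,j})`. -/
def annSpace (σE : RingAut E) {m r : ℕ} (Q : Fin r → F[X]) (P : Fin m → Fin r → E)
    (n : Fin m → Fin r → ℕ) (j : Fin r) :
    Submodule (constants σE) (Fin m → constants σE) :=
  Ann σE fun i => toRat (Q j ^ ((Finset.univ.sup fun k => n k j) - n i j)) • P i j

end XDegree

end RefinedTelescoping

end

/-! Call an irreducible polynomial bad if it has period `0` and degree `> d` (`IsBad`). The reduced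
power products form an `F(x)`-basis of `E`. So an element has no pole at an irreducible `p`, i.e.
`p` does not divide its denominator, exactly when it lies in the same tower built over the local
ring of `F[x]` at `p`. All statements about denominators are proved as such memberships.

On `F[x]` the map `σ` restricts to a degree preserving automorphism `τ`. The bound on the `x`-degree
says that the data defining every `σ(tᵢ)` are regular at all bad polynomials. Hence `g` has a pole
at a bad `p` if and only if `σ(g)` has one at `τ p` (`map_mem_iff`).

The heart is `mem_level_of_telescoping`. Period `0` makes the polynomials `τ^k p` pairwise
non-associated, so `g` has poles at only finitely many of them. If there are any, let `l` be the
least and `k` the greatest exponent that occurs. Then `σ(g) - g` has a pole at `τ^l p`, where `σ(g)`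
has none, and at `τ^(k+1) p`, where `g` has none. These are two distinct poles in one orbit. A
right-hand side whose bad poles all lie in a `(d,x)`-set has at most one per orbit, so `g` has no
bad pole at all.

Consequently `σ(g) - g` is regular at each `q_j`, and so is the term `N_j / q_j ^ μ_j` of the
combined reduced form. This fraction is proper, hence `N_j = 0` (`numerators_eq_zero`), which is the
condition `c ∈ V_j`. Adding or subtracting `∑ cᵢ gᵢ` passes between the `fᵢ` and the `f'ᵢ`.

If the remaining equation with right-hand side `β` is unsolvable, a variable with `σ(X) = X + β` is
adjoined. In characteristic `0`, comparing the two top coefficients of a constant of positive degree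
would yield a telescoper of `β`, so no new constants appear (`sigmaAut_constants`). Since `β` has no
bad poles, the degree bound persists. -/

noncomputable section

namespace RefinedTelescoping

/-! ### Reduced power products -/

section PowerProducts

variable {E : Type*} [CommRing E] {e : ℕ}

/-- Reduced exponents of a single monomial. -/
def ReducedExponent (k : MonomialKind) (n : ℤ) : Prop :=
  match k with
  | .root ν => 0 ≤ n ∧ n < ν
  | .pi => True
  | .sigma => 0 ≤ n

/-- The multiplicative relation that a monomial of the given kind satisfies. -/
def PowerLaw (k : MonomialKind) (t : E) : Prop :=
  match k with
  | .root ν => 1 < ν ∧ t ^ ν = 1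
  | .pi => IsUnit t
  | .sigma => True

theorem isReduced_iff {kind : Fin e → MonomialKind} {n : Fin e → ℤ} :
    IsReduced kind n ↔ ∀ i, ReducedExponent (kind i) (n i) := Iff.rfl

theorem ReducedExponent.zero {k : MonomialKind} {t : E} (h : PowerLaw k t) :
    ReducedExponent k 0 := by
  cases k <;> simp_all [ReducedExponent, PowerLaw]; omega

theorem ReducedExponent.one {k : MonomialKind} {t : E} (h : PowerLaw k t) :
    ReducedExponent k 1 := by
  cases k <;> simp_all [ReducedExponent, PowerLaw]

@[simp] theorem ipow_zero (t : E) : ipow t 0 = 1 := by simp [ipow]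

@[simp] theorem ipow_one (t : E) : ipow t 1 = t := by simp [ipow]

theorem ipow_of_nonneg (t : E) {n : ℤ} (h : 0 ≤ n) : ipow t n = t ^ n.toNat := if_pos h

theorem ipow_unit (u : Eˣ) (n : ℤ) : ipow (u : E) n = ((u ^ n : Eˣ) : E) := by
  rcases le_or_gt 0 n with h | h
  · lift n to ℕ using h
    simp [ipow]
  · obtain ⟨k, rfl⟩ : ∃ k : ℕ, n = -k := ⟨n.natAbs, by omega⟩
    have : ¬ (0 : ℤ) ≤ -(k : ℤ) := by omega
    rw [ipow, if_neg this]
    simp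

/-- Exponents add, modulo `ν` for an R-monomial. The last clause keeps a product of power products
in the first `i` monomials free of later monomials. -/
theorem PowerLaw.ipow_mul {k : MonomialKind} {t : E} (h : PowerLaw k t) {a b : ℤ}
    (ha : ReducedExponent k a) (hb : ReducedExponent k b) :
    ∃ c, ReducedExponent k c ∧ ipow t a * ipow t b = ipow t c ∧ (a = 0 → b = 0 → c = 0) := by
  cases k with
  | root ν =>
    obtain ⟨hν, ht⟩ := h
    obtain ⟨ha, -⟩ := ha
    obtain ⟨hb, -⟩ := hb
    lift a to ℕ using ha
    lift b to ℕ using hb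
    refine ⟨((a + b) % ν : ℕ), ⟨by positivity, by exact_mod_cast Nat.mod_lt _ (by omega)⟩, ?_, ?_⟩
    · rw [ipow_of_nonneg _ (by positivity), ipow_of_nonneg _ (by positivity),
        ipow_of_nonneg _ (by positivity), Int.toNat_natCast, Int.toNat_natCast, Int.toNat_natCast,
        ← pow_add]
      exact pow_eq_pow_mod _ ht
    · intro h1 h2
      simp_all
  | pi =>
    obtain ⟨u, rfl⟩ := h
    refine ⟨a + b, trivial, ?_, by omega⟩
    simp [ipow_unit, zpow_add]
  | sigma =>
    have ha' : 0 ≤ a := ha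
    have hb' : 0 ≤ b := hb
    refine ⟨a + b, add_nonneg ha' hb', ?_, by omega⟩
    rw [ipow_of_nonneg _ ha', ipow_of_nonneg _ hb', ipow_of_nonneg _ (add_nonneg ha' hb'),
      Int.toNat_add ha' hb', pow_add]

theorem powerProduct_single (t : Fin e → E) (i : Fin e) (k : ℤ) :
    powerProduct t (Pi.single i k) = ipow (t i) k := by
  rw [powerProduct, Finset.prod_eq_single i]
  · simp
  · intro j _ hj
    simp [Pi.single_eq_of_ne hj]
  · simp

theorem powerProduct_eq_update_mul (t : Fin e → E) (n : Fin e → ℤ) (i : Fin e) :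
    powerProduct t n = powerProduct t (Function.update n i 0) * ipow (t i) (n i) := by
  classical
  rw [powerProduct, powerProduct, ← Finset.mul_prod_erase _ _ (Finset.mem_univ i),
    ← Finset.mul_prod_erase (a := i) Finset.univ
      (fun j => ipow (t j) (Function.update n i 0 j)) (Finset.mem_univ i)]
  simp only [Function.update_self, ipow_zero, one_mul]
  rw [mul_comm]
  congr 1
  refine Finset.prod_congr rfl fun j hj => ?_
  rw [Function.update_of_ne (Finset.ne_of_mem_erase hj)]

/-- The reduced exponent vectors that involve only the first `i` monomials. -/
def reducedBelow (kind : Fin e → MonomialKind) (i : ℕ) : Set (Fin e → ℤ) :=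
  {n | IsReduced kind n ∧ ∀ j : Fin e, i ≤ (j : ℕ) → n j = 0}

/-- The monoid of reduced power products in the first `i` monomials. -/
def reducedProducts (kind : Fin e → MonomialKind) (t : Fin e → E)
    (h : ∀ i, PowerLaw (kind i) (t i)) (i : ℕ) : Submonoid E where
  carrier := powerProduct t '' reducedBelow kind i
  one_mem' := ⟨0, ⟨isReduced_iff.2 fun j => ReducedExponent.zero (h j), by simp⟩,
    by simp [powerProduct]⟩
  mul_mem' := by
    rintro _ _ ⟨a, ha, rfl⟩ ⟨b, hb, rfl⟩
    choose c hc hab h0 using fun j => (h j).ipow_mul (ha.1 j) (hb.1 j)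
    refine ⟨c, ⟨hc, fun j hj => h0 j (ha.2 j hj) (hb.2 j hj)⟩, ?_⟩
    simp only [powerProduct, ← Finset.prod_mul_distrib]
    exact Finset.prod_congr rfl fun j _ => (hab j).symm

end PowerProducts

/-! ### Levels of the tower as spans of reduced power products -/

section Levels

variable {A E : Type*} [CommRing A] [CommRing E] [Algebra A E] {e : ℕ}
  {kind : Fin e → MonomialKind} {t : Fin e → E}

theorem level_mono {i i' : ℕ} (h : i ≤ i') : level A kind t i ≤ level A kind t i' :=
  Algebra.adjoin_mono fun _ ⟨j, hj, hy⟩ => ⟨j, hj.trans_le h, hy⟩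

theorem monomial_mem_level {i : ℕ} {j : Fin e} (hj : (j : ℕ) < i) : t j ∈ level A kind t i :=
  Algebra.subset_adjoin ⟨j, hj, Or.inl rfl⟩

theorem inverse_mem_level (h : ∀ i, PowerLaw (kind i) (t i)) {i : ℕ} {j : Fin e}
    (hj : (j : ℕ) < i) (hk : kind j ≠ .sigma) : Ring.inverse (t j) ∈ level A kind t i := by
  have hj' := h j
  rcases hkj : kind j with ν | _ | _
  · rw [hkj] at hj'
    obtain ⟨hν, ht⟩ := hj'
    have hu : t j * t j ^ (ν - 1) = 1 := by rw [mul_pow_sub_one (by omega), ht]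
    have : Ring.inverse (t j) = t j ^ (ν - 1) :=
      Ring.inverse_unit (Units.mkOfMulEqOne _ _ hu)
    rw [this]
    exact pow_mem (monomial_mem_level hj) _
  · exact Algebra.subset_adjoin ⟨j, hj, Or.inr ⟨hkj, rfl⟩⟩
  · exact absurd hkj hk

theorem ipow_mem_level (h : ∀ i, PowerLaw (kind i) (t i)) {i : ℕ} {j : Fin e}
    (hj : (j : ℕ) < i) {n : ℤ} (hk : kind j = .sigma → 0 ≤ n) :
    ipow (t j) n ∈ level A kind t i := by
  by_cases hn : 0 ≤ n
  · rw [ipow_of_nonneg _ hn]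
    exact pow_mem (monomial_mem_level hj) _
  · rw [ipow, if_neg hn]
    exact pow_mem (inverse_mem_level h hj fun hs => hn (hk hs)) _

theorem powerProduct_mem_level (h : ∀ i, PowerLaw (kind i) (t i)) {i : ℕ} {n : Fin e → ℤ}
    (hn : ∀ j : Fin e, i ≤ (j : ℕ) → n j = 0) (hk : ∀ j, kind j = .sigma → 0 ≤ n j) :
    powerProduct t n ∈ level A kind t i := by
  refine prod_mem fun j _ => ?_
  rcases lt_or_ge (j : ℕ) i with hj | hj
  · exact ipow_mem_level h hj (hk j)
  · simp [hn j hj]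

theorem IsReduced.nonneg_of_sigma {n : Fin e → ℤ} (hn : IsReduced kind n) (j : Fin e)
    (hj : kind j = .sigma) : 0 ≤ n j := by
  have : ReducedExponent (kind j) (n j) := hn j
  rw [hj] at this
  exact this

/-- The algebra generated by a set is the span of the monoid it generates, and the reduced power
products already form a monoid containing the generators. -/
theorem toSubmodule_level (h : ∀ i, PowerLaw (kind i) (t i)) (i : ℕ) :
    Subalgebra.toSubmodule (level A kind t i) =
      Submodule.span A (powerProduct t '' reducedBelow kind i) := by
  apply le_antisymm
  · rw [level, Algebra.adjoin_eq_span]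
    refine Submodule.span_mono ?_
    change _ ≤ reducedProducts kind t h i
    rw [Submonoid.closure_le]
    rintro _ ⟨j, hj, rfl | ⟨hk, rfl⟩⟩
    · refine ⟨Pi.single j 1, ⟨isReduced_iff.2 fun l => ?_, fun l hl => ?_⟩, ?_⟩
      · rcases eq_or_ne l j with rfl | hl
        · simpa using ReducedExponent.one (h l)
        · simpa [hl] using ReducedExponent.zero (h l)
      · rw [Pi.single_eq_of_ne]
        rintro rfl
        omega
      · simp [powerProduct_single]
    · refine ⟨Pi.single j (-1), ⟨isReduced_iff.2 fun l => ?_, fun l hl => ?_⟩, ?_⟩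
      · rcases eq_or_ne l j with rfl | hl
        · rw [hk]
          trivial
        · simpa [hl] using ReducedExponent.zero (h l)
      · rw [Pi.single_eq_of_ne]
        rintro rfl
        omega
      · simp [powerProduct_single, ipow]
  · rw [Submodule.span_le]
    rintro _ ⟨n, ⟨hn, hn'⟩, rfl⟩
    exact powerProduct_mem_level h hn' hn.nonneg_of_sigma

/-- Elements of the `i`-th level over `O` have expansions with coefficients in `O`. -/
theorem exists_isExpansion_of_mem_level {O : Type*} [CommRing O] [Algebra O A] [Algebra O E]
    [IsScalarTower O A E] (h : ∀ i, PowerLaw (kind i) (t i)) {i : ℕ} {y : E}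
    (hy : y ∈ level O kind t i) :
    ∃ φ : (Fin e → ℤ) →₀ A, IsExpansion kind t y φ ∧ (↑φ.support ⊆ reducedBelow kind i) ∧
      ∀ n, φ n ∈ (algebraMap O A).range := by
  have hy' : y ∈ Subalgebra.toSubmodule (level O kind t i) := hy
  rw [toSubmodule_level h, Finsupp.mem_span_image_iff_linearCombination] at hy'
  obtain ⟨l, hl, rfl⟩ := hy'
  have hsub : (↑(l.mapRange (algebraMap O A) (map_zero _)).support : Set (Fin e → ℤ)) ⊆
      reducedBelow kind i := fun n hn =>
    hl (Finsupp.support_mapRange (f := algebraMap O A) (hf := map_zero _) hn)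
  refine ⟨l.mapRange (algebraMap O A) (map_zero _), ⟨fun n hn => (hsub hn).1, ?_⟩, hsub, fun n => ?_⟩
  · rw [Finsupp.sum_mapRange_index (by simp), Finsupp.linearCombination_apply]
    simp
  · simp

/-! ### Linear independence of the reduced power products -/

/-- A linear relation between powers of `x` becomes, after multiplication by a suitable `x ^ N`, a
polynomial relation over `B`, which the definition of the monomial excludes. -/
theorem linearIndependent_ipow {B : Subalgebra A E} {σ : RingAut E} {x : E} {k : MonomialKind}
    (h : IsMonomial σ B x k) :
    LinearIndependent B fun n : {n : ℤ // ReducedExponent k n} => ipow x n := by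
  -- The degree bound in the third hypothesis serves the R-monomials: they do satisfy a polynomial
  -- relation, but none of degree `< ν`.
  have key : ∀ N : ℤ, (∀ n, ReducedExponent k n → ipow x n * ipow x N = ipow x (n + N)) →
      ∀ l : {n : ℤ // ReducedExponent k n} →₀ B, (∀ n ∈ l.support, 0 ≤ (n : ℤ) + N) →
      (∀ p : B[X], aeval x p = 0 → p.degree < (l.support.sup fun n => ((n : ℤ) + N).toNat + 1 : ℕ) →
        p = 0) →
      l.sum (fun n b => b • ipow x n) = 0 → l = 0 := by
    intro N hN l hl hp h0
    set p : B[X] := ∑ n ∈ l.support, Polynomial.monomial ((n : ℤ) + N).toNat (l n) with hpdef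
    have hp0 : p = 0 := by
      apply hp
      · rw [hpdef, map_sum]
        have := congrArg (· * ipow x N) h0
        simp only [zero_mul] at this
        rw [← this, Finsupp.sum, Finset.sum_mul]
        refine Finset.sum_congr rfl fun n hn => ?_
        rw [aeval_monomial, smul_mul_assoc, hN n n.2, ipow_of_nonneg _ (hl n hn), Algebra.smul_def]
      · refine (Polynomial.degree_sum_le _ _).trans_lt ?_
        rw [Finset.sup_lt_iff (WithBot.bot_lt_coe _)]
        intro n hn
        refine (degree_monomial_le _ _).trans_lt ?_
        refine WithBot.coe_lt_coe.2 ?_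
        exact Nat.lt_of_succ_le
          (Finset.le_sup (f := fun n : {n : ℤ // ReducedExponent k n} => ((n : ℤ) + N).toNat + 1) hn)
    ext1 n
    by_cases hn : n ∈ l.support
    · have hc := congrArg (fun q : B[X] => q.coeff ((n : ℤ) + N).toNat) hp0
      simp only [hpdef, Polynomial.finsetSum_coeff, coeff_zero] at hc
      rw [Finset.sum_eq_single n] at hc
      · simpa using hc
      · intro n' hn' hne
        rw [coeff_monomial, if_neg]
        intro heq
        have h1 := hl n hn
        have h2 := hl n' hn'
        exact hne (Subtype.ext (by omega))
      · exact fun h => absurd hn h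
    · simpa using hn
  rw [linearIndependent_iff]
  intro l hl0
  rw [Finsupp.linearCombination_apply] at hl0
  cases k with
  | root ν =>
    obtain ⟨hν, hker, -⟩ := h
    refine key 0 (by simp) l (fun n _ => by simpa using n.2.1) (fun p hp hdeg => ?_) hl0
    have hmem : p ∈ RingHom.ker (aeval x : B[X] →ₐ[B] E) := hp
    rw [hker, Ideal.mem_span_singleton] at hmem
    have hmon : (X ^ ν - 1 : B[X]).Monic := by
      simpa using monic_X_pow_sub_C (1 : B) (by omega : ν ≠ 0)
    by_contra hpne
    refine hmon.not_dvd_of_degree_lt hpne (hdeg.trans_le ?_) hmem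
    -- Over the zero ring `X ^ ν - 1` would not have degree `ν`.
    have : Nontrivial B := by
      by_contra hB
      rw [not_nontrivial_iff_subsingleton] at hB
      exact hpne (Subsingleton.elim _ _)
    have : (X ^ ν - 1 : B[X]).degree = ν := by
      simpa using degree_X_pow_sub_C (by omega : 0 < ν) (1 : B)
    rw [this]
    refine WithBot.coe_le_coe.2 (Finset.sup_le fun n _ => ?_)
    have := n.2
    obtain ⟨h1, h2⟩ := this
    simp only [add_zero]
    change (n : ℤ).toNat + 1 ≤ ν
    omega
  | pi =>
    obtain ⟨⟨u, rfl⟩, htr, -⟩ := h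
    -- This shift is at least `|n|` for every exponent `n` that occurs, so it clears all negative
    -- powers.
    refine key (∑ n ∈ l.support, |(n : ℤ)|) (fun n _ => by simp [ipow_unit, zpow_add]) l
      (fun n hn => ?_) (fun p hp _ => ?_) hl0
    · have := Finset.single_le_sum (f := fun n : {n : ℤ // ReducedExponent .pi n} => |(n : ℤ)|)
        (fun _ _ => abs_nonneg _) hn
      have := neg_abs_le (n : ℤ)
      lia
    · by_contra hne
      exact htr ⟨p, hne, hp⟩
  | sigma =>
    obtain ⟨htr, -⟩ := h
    refine key 0 (by simp) l (fun n _ => by rw [add_zero]; exact n.2) (fun p hp _ => ?_) hl0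
    by_contra hne
    exact htr ⟨p, hne, hp⟩

theorem IsMonomial.powerLaw {B : Subalgebra A E} {σ : RingAut E} {x : E} {k : MonomialKind}
    (h : IsMonomial σ B x k) : PowerLaw k x := by
  cases k with
  | root ν =>
    refine ⟨h.1, ?_⟩
    have : (X ^ ν - 1 : B[X]) ∈ RingHom.ker (aeval x : B[X] →ₐ[B] E) := by
      rw [h.2.1]
      exact Ideal.mem_span_singleton_self _
    simpa [RingHom.mem_ker, sub_eq_zero] using this
  | pi => exact h.1
  | sigma => trivial

/-- Induction along the tower: products of a basis of level `i` over `A` with the independent powers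
of the next monomial over level `i` are independent over `A`. -/
theorem linearIndepOn_powerProduct {σ : RingAut E}
    (hinj : Function.Injective (algebraMap A E))
    (h : ∀ i : Fin e, IsMonomial σ (level A kind t i) (t i) (kind i)) (i : ℕ) (hi : i ≤ e) :
    LinearIndepOn A (powerProduct t) (reducedBelow kind i) := by
  have hpl : ∀ i, PowerLaw (kind i) (t i) := fun i => (h i).powerLaw
  induction i with
  | zero =>
    have hz : ∀ n : reducedBelow kind 0, (n : Fin e → ℤ) = 0 := fun n =>
      funext fun j => n.2.2 j (Nat.zero_le _)
    have : Subsingleton (reducedBelow kind 0) :=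
      ⟨fun a b => Subtype.ext ((hz a).trans (hz b).symm)⟩
    rw [LinearIndepOn, linearIndependent_iff']
    intro s g hg n hn
    have hs : s = {n} := by
      ext m
      simp [Subsingleton.elim m n, hn]
    rw [hs, Finset.sum_singleton, hz n] at hg
    apply hinj
    simpa [powerProduct, Algebra.smul_def] using hg
  | succ i ih =>
    set x : Fin e := ⟨i, hi⟩
    have hb : LinearIndependent A (fun n : reducedBelow kind i =>
        (⟨powerProduct t n, powerProduct_mem_level hpl n.2.2 n.2.1.nonneg_of_sigma⟩ :
          level A kind t i)) :=
      LinearIndependent.of_comp (level A kind t i).val.toLinearMap (ih (by omega))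
    have hbc := linearIndependent_smul hb (linearIndependent_ipow (h x))
    -- Splits off the exponent of the top monomial `x`.
    let ψ : reducedBelow kind (i + 1) →
        reducedBelow kind i × {n : ℤ // ReducedExponent (kind x) n} := fun n =>
      (⟨Function.update n x 0, isReduced_iff.2 fun j => by
          rcases eq_or_ne j x with rfl | hj
          · simpa using ReducedExponent.zero (hpl _)
          · rw [Function.update_of_ne hj]
            exact n.2.1 j, fun j hj => by
          rcases eq_or_ne j x with rfl | hj'
          · simp
          · rw [Function.update_of_ne hj']
            refine n.2.2 j (lt_of_le_of_ne hj fun h => hj' (Fin.ext h.symm))⟩, ⟨n.1 x, n.2.1 x⟩)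
    have hψ : Function.Injective ψ := by
      intro a b hab
      have h1 := congrArg (fun z => (z.1 : Fin e → ℤ)) hab
      have h2 := congrArg (fun z => (z.2 : ℤ)) hab
      refine Subtype.ext (funext fun j => ?_)
      rcases eq_or_ne j x with rfl | hj
      · exact h2
      · simpa [ψ, hj] using congrFun h1 j
    have := hbc.comp ψ hψ
    rw [LinearIndepOn]
    convert this using 1
    funext n
    simp only [Function.comp_apply, ψ]
    rw [powerProduct_eq_update_mul t n x]
    rfl

end Levels

/-! ### Existence, uniqueness and linearity of the coefficients -/

section Coefficients

variable {A E : Type*} [CommRing A] [CommRing E] [Algebra A E] {e : ℕ}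
  {kind : Fin e → MonomialKind} {t : Fin e → E} {σA : RingAut A} {σE : RingAut E}

theorem IsRPiSigmaExt.powerLaw (h : IsRPiSigmaExt σA σE kind t) (i : Fin e) :
    PowerLaw (kind i) (t i) := (h.monomial i).powerLaw

theorem mem_reducedBelow_length {n : Fin e → ℤ} (hn : IsReduced kind n) :
    n ∈ reducedBelow kind e := ⟨hn, fun j hj => absurd j.2 (not_lt.2 hj)⟩

theorem IsRPiSigmaExt.expansion_unique (h : IsRPiSigmaExt σA σE kind t) {f : E}
    {φ ψ : (Fin e → ℤ) →₀ A} (hφ : IsExpansion kind t f φ) (hψ : IsExpansion kind t f ψ) :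
    φ = ψ := by
  have hli := linearIndepOn_powerProduct h.injective h.monomial e le_rfl
  rw [linearIndepOn_iffₛ] at hli
  refine hli φ (fun n hn => mem_reducedBelow_length (hφ.reduced n hn)) ψ
    (fun n hn => mem_reducedBelow_length (hψ.reduced n hn)) ?_
  rw [Finsupp.linearCombination_apply, Finsupp.linearCombination_apply, ← hφ.eq_sum, ← hψ.eq_sum]

theorem IsRPiSigmaExt.isExpansion_coeffs (h : IsRPiSigmaExt σA σE kind t) (f : E) :
    IsExpansion kind t f (coeffs A kind t f) := by
  have hf : f ∈ level A kind t e := h.generates ▸ Algebra.mem_top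
  obtain ⟨φ, hφ, -⟩ := exists_isExpansion_of_mem_level (A := A) h.powerLaw hf
  have hex : ∃ φ : (Fin e → ℤ) →₀ A, IsExpansion kind t f φ := ⟨φ, hφ⟩
  rw [coeffs, dif_pos hex]
  exact hex.choose_spec

theorem IsRPiSigmaExt.coeffs_eq (h : IsRPiSigmaExt σA σE kind t) {f : E}
    {φ : (Fin e → ℤ) →₀ A} (hφ : IsExpansion kind t f φ) : coeffs A kind t f = φ :=
  h.expansion_unique (h.isExpansion_coeffs f) hφ

theorem IsExpansion.add {f g : E} {φ ψ : (Fin e → ℤ) →₀ A} (hφ : IsExpansion kind t f φ)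
    (hψ : IsExpansion kind t g ψ) : IsExpansion kind t (f + g) (φ + ψ) where
  reduced n hn := by
    classical
    rcases Finset.mem_union.1 (Finsupp.support_add hn) with h | h
    · exact hφ.reduced n h
    · exact hψ.reduced n h
  eq_sum := by
    classical
    rw [Finsupp.sum_add_index' (by simp) (by simp [add_smul]), ← hφ.eq_sum, ← hψ.eq_sum]

theorem IsExpansion.smul {f : E} {φ : (Fin e → ℤ) →₀ A} (hφ : IsExpansion kind t f φ) (a : A) :
    IsExpansion kind t (a • f) (a • φ) where
  reduced n hn := hφ.reduced n (Finsupp.support_smul hn)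
  eq_sum := by
    rw [Finsupp.sum_smul_index' (by simp)]
    conv_lhs => rw [hφ.eq_sum, Finsupp.smul_sum]
    simp [mul_smul]

/-- The coefficients as a linear map. -/
def IsRPiSigmaExt.coeffsLinear (h : IsRPiSigmaExt σA σE kind t) : E →ₗ[A] (Fin e → ℤ) →₀ A where
  toFun := coeffs A kind t
  map_add' f g := h.coeffs_eq ((h.isExpansion_coeffs f).add (h.isExpansion_coeffs g))
  map_smul' a f := h.coeffs_eq ((h.isExpansion_coeffs f).smul a)

theorem IsRPiSigmaExt.eq_zero_of_coeffs_eq_zero (h : IsRPiSigmaExt σA σE kind t) {f : E}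
    (hf : ∀ n, coeffs A kind t f n = 0) : f = 0 := by
  rw [(h.isExpansion_coeffs f).eq_sum, Finsupp.sum]
  exact Finset.sum_eq_zero fun n _ => by rw [hf n, zero_smul]

/-- Membership in a level over a subring `O` is decided by the coefficients. -/
theorem IsRPiSigmaExt.mem_level_subring (h : IsRPiSigmaExt σA σE kind t) (O : Subring A) {i : ℕ}
    {f : E} (hf : f ∈ level A kind t i) :
    f ∈ level O kind t i ↔ ∀ n, coeffs A kind t f n ∈ O := by
  constructor
  · intro hO n
    obtain ⟨φ, hφ, -, hφO⟩ := exists_isExpansion_of_mem_level (A := A) h.powerLaw hO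
    rw [h.coeffs_eq hφ]
    obtain ⟨o, ho⟩ := hφO n
    exact ho ▸ o.2
  · intro hO
    obtain ⟨φ, hφ, hsupp, -⟩ := exists_isExpansion_of_mem_level (A := A) h.powerLaw hf
    rw [h.coeffs_eq hφ] at hO
    rw [hφ.eq_sum]
    refine sum_mem fun n hn => ?_
    exact Subalgebra.smul_mem (level O kind t i) (powerProduct_mem_level h.powerLaw (hsupp hn).2
      (hsupp hn).1.nonneg_of_sigma) (⟨φ n, hO n⟩ : O)

theorem IsRPiSigmaExt.mem_level_length (h : IsRPiSigmaExt σA σE kind t) (f : E) :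
    f ∈ level A kind t e := h.generates ▸ Algebra.mem_top

end Coefficients

/-! ### The action of `σ` on polynomials and their localizations -/

section BaseField

variable {F : Type*} [Field F] {σF : RingAut F} {σ : RingAut (RatFunc F)}

theorem toRat_injective : Function.Injective (toRat : F[X] → RatFunc F) :=
  RatFunc.algebraMap_injective F

theorem toRat_add (a b : F[X]) : toRat (a + b) = toRat a + toRat b := map_add _ a b

theorem toRat_mul (a b : F[X]) : toRat (a * b) = toRat a * toRat b := map_mul _ a b

theorem toRat_neg (a : F[X]) : toRat (-a) = -toRat a := map_neg _ a

/-- This symmetry supplies the inverse of the action on `F[x]` and the negative powers of `σ`. -/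
theorem IsPiSigmaFieldExt.symm (h : IsPiSigmaFieldExt σF σ) : IsPiSigmaFieldExt σF⁻¹ σ⁻¹ where
  extends_base a := by
    apply σ.injective
    rw [h.extends_base]
    change σ (σ.symm _) = RatFunc.C (σF (σF.symm a))
    simp
  constants_eq y hy := by
    have hy' : σ y = y := by
      conv_lhs => rw [← hy]
      exact σ.apply_symm_apply y
    obtain ⟨a, ha, hay⟩ := h.constants_eq y hy'
    refine ⟨a, ?_, hay⟩
    conv_lhs => rw [← ha]
    exact σF.symm_apply_apply a
  monomial := by
    have hX : (RatFunc.X : RatFunc F) ≠ 0 := RatFunc.X_ne_zero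
    have hC : ∀ a, σ (RatFunc.C (σF.symm a)) = RatFunc.C a := fun a => by simp [h.extends_base]
    rcases h.monomial with ⟨a, ha, hax⟩ | ⟨b, hb⟩
    · left
      rw [div_eq_iff hX] at hax
      refine ⟨σF.symm a⁻¹, by simpa using ha, ?_⟩
      rw [div_eq_iff hX]
      apply σ.injective
      rw [map_mul, hC, hax]
      change σ (σ.symm _) = _
      rw [RingEquiv.apply_symm_apply, map_inv₀, inv_mul_cancel_left₀ (by simpa using ha)]
    · right
      refine ⟨-σF.symm b, ?_⟩
      apply σ.injective
      rw [map_sub, map_neg, map_neg, hC, ← hb]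
      change σ (σ.symm _) - _ = _
      simp

/-- In both cases `σ(x)` is a polynomial of degree one in `x`, so `σ` twists the coefficients and
substitutes a linear polynomial. -/
theorem IsPiSigmaFieldExt.exists_polynomialHom (h : IsPiSigmaFieldExt σF σ) :
    ∃ φ : F[X] →+* F[X], (∀ p, toRat (φ p) = σ (toRat p)) ∧
      ∀ p, (φ p).natDegree = p.natDegree := by
  obtain ⟨y, hy, hdeg⟩ : ∃ y : F[X], toRat y = σ RatFunc.X ∧ y.natDegree = 1 := by
    rcases h.monomial with ⟨a, ha, hax⟩ | ⟨b, hb⟩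
    · rw [div_eq_iff RatFunc.X_ne_zero] at hax
      exact ⟨C a * X, by simp [hax], natDegree_C_mul_X a ha⟩
    · rw [sub_eq_iff_eq_add] at hb
      exact ⟨C b + X, by simp [hb], by rw [add_comm]; exact natDegree_X_add_C b⟩
  refine ⟨eval₂RingHom ((C : F →+* F[X]).comp (σF : F →+* F)) y, fun p => ?_, fun p => ?_⟩
  · have : ((algebraMap F[X] (RatFunc F)).comp
        (eval₂RingHom ((C : F →+* F[X]).comp (σF : F →+* F)) y)) =
        (σ : RatFunc F →+* RatFunc F).comp (algebraMap F[X] (RatFunc F)) := by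
      apply Polynomial.ringHom_ext
      · intro a
        simp [h.extends_base]
      · simpa using hy
    exact RingHom.congr_fun this p
  · have : eval₂RingHom ((C : F →+* F[X]).comp (σF : F →+* F)) y p =
        (p.map (σF : F →+* F)).comp y := by
      rw [coe_eval₂RingHom, Polynomial.comp, eval₂_map]
    rw [this, natDegree_comp, hdeg, mul_one, natDegree_map_eq_of_injective σF.injective]

/-- `σ` restricts to a degree preserving automorphism of `F[x]`. -/
theorem IsPiSigmaFieldExt.exists_polynomialAut (h : IsPiSigmaFieldExt σF σ) :
    ∃ τ : RingAut F[X], (∀ p, toRat (τ p) = σ (toRat p)) ∧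
      ∀ p, (τ p).natDegree = p.natDegree := by
  obtain ⟨φ, hφ, hdeg⟩ := h.exists_polynomialHom
  obtain ⟨ψ, hψ, -⟩ := h.symm.exists_polynomialHom
  refine ⟨RingEquiv.ofRingHom φ ψ ?_ ?_, hφ, hdeg⟩
  · apply Polynomial.ringHom_ext
    · intro a
      apply toRat_injective
      simp only [RingHom.comp_apply]
      rw [hφ, hψ]
      exact σ.apply_symm_apply _
    · apply toRat_injective
      simp only [RingHom.comp_apply]
      rw [hφ, hψ]
      exact σ.apply_symm_apply _
  · apply Polynomial.ringHom_ext
    · intro a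
      apply toRat_injective
      simp only [RingHom.comp_apply]
      rw [hψ, hφ]
      exact σ.symm_apply_apply _
    · apply toRat_injective
      simp only [RingHom.comp_apply]
      rw [hψ, hφ]
      exact σ.symm_apply_apply _

theorem toRat_zpow {τ : RingAut F[X]} (hτ : ∀ p, toRat (τ p) = σ (toRat p)) (k : ℤ) (p : F[X]) :
    toRat ((τ ^ k) p) = (σ ^ k) (toRat p) := by
  induction k using Int.induction_on generalizing p with
  | zero => simp
  | succ k ih =>
    rw [zpow_add_one, zpow_add_one, RingAut.mul_apply, RingAut.mul_apply, ih, hτ]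
  | pred k ih =>
    rw [zpow_sub_one, zpow_sub_one, RingAut.mul_apply, RingAut.mul_apply, ih]
    congr 1
    apply σ.injective
    rw [← hτ]
    change toRat (τ (τ.symm p)) = σ (σ.symm (toRat p))
    simp

theorem inBase_zpow_apply (h : IsPiSigmaFieldExt σF σ) (k : ℤ) {y : RatFunc F} (hy : InBase y) :
    InBase ((σ ^ k) y) := by
  obtain ⟨a, rfl⟩ := hy
  induction k using Int.induction_on generalizing a with
  | zero => exact ⟨a, rfl⟩
  | succ k ih =>
    rw [zpow_add_one, RingAut.mul_apply, h.extends_base]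
    exact ih _
  | pred k ih =>
    rw [zpow_sub_one, RingAut.mul_apply, h.symm.extends_base]
    exact ih _

theorem period_eq_zero_iff (y : RatFunc F) :
    period σ y = 0 ↔ ∀ n : ℕ, 0 < n → ¬ InBase ((σ ^ n) y / y) := by
  rw [period, Nat.sInf_eq_zero]
  simp [Set.eq_empty_iff_forall_notMem]

/-- The powers of `σ` commute and preserve `F`, so `σ^(-k)` carries a relation for `σ^k(y)` back to
one for `y`. -/
theorem period_eq_zero_apply_zpow (h : IsPiSigmaFieldExt σF σ) (k : ℤ) {y : RatFunc F}
    (hy : period σ y = 0) : period σ ((σ ^ k) y) = 0 := by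
  rw [period_eq_zero_iff] at hy ⊢
  intro n hn hb
  refine hy n hn ?_
  have := inBase_zpow_apply h (-k) hb
  rw [map_div₀] at this
  convert this using 2
  · rw [← zpow_natCast, ← RingAut.mul_apply, ← RingAut.mul_apply, ← zpow_add, ← zpow_add]
    congr 2
    ring
  · rw [← RingAut.mul_apply, ← zpow_add]
    simp

theorem inBase_div_of_associated {p q : F[X]} (hq : q ≠ 0) (h : Associated p q) :
    InBase (toRat p / toRat q) := by
  obtain ⟨u, hu⟩ := h.symm
  obtain ⟨a, -, ha⟩ := Polynomial.isUnit_iff.1 u.isUnit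
  refine ⟨a, ?_⟩
  rw [eq_div_iff (by simpa using hq), ← hu, ← ha, mul_comm]
  simp

/-- Polynomials whose occurrence in a denominator the `x`-degree bound `d` forbids. -/
structure IsBad (σ : RingAut (RatFunc F)) (d : ℕ) (p : F[X]) : Prop where
  irreducible : Irreducible p
  period_eq_zero : period σ (toRat p) = 0
  lt_natDegree : d < p.natDegree

theorem natDegree_zpow {τ : RingAut F[X]} (hdeg : ∀ p, (τ p).natDegree = p.natDegree) (k : ℤ)
    (p : F[X]) : ((τ ^ k) p).natDegree = p.natDegree := by
  induction k using Int.induction_on generalizing p with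
  | zero => simp
  | succ k ih => rw [zpow_add_one, RingAut.mul_apply, ih, hdeg]
  | pred k ih =>
    rw [zpow_sub_one, RingAut.mul_apply, ih, ← hdeg]
    change (τ (τ.symm p)).natDegree = _
    rw [RingEquiv.apply_symm_apply]

theorem IsBad.zpow (h : IsPiSigmaFieldExt σF σ) {τ : RingAut F[X]}
    (hτ : ∀ p, toRat (τ p) = σ (toRat p)) (hdeg : ∀ p, (τ p).natDegree = p.natDegree) {d : ℕ}
    {p : F[X]} (hp : IsBad σ d p) (k : ℤ) : IsBad σ d ((τ ^ k) p) where
  irreducible := (MulEquiv.irreducible_iff ((τ ^ k : RingAut F[X]) : F[X] ≃+* F[X])).2 hp.irreducible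
  period_eq_zero := by
    rw [toRat_zpow hτ]
    exact period_eq_zero_apply_zpow h k hp.period_eq_zero
  lt_natDegree := by
    rw [natDegree_zpow hdeg]
    exact hp.lt_natDegree

/-- If `l < k`, associatedness would make `k - l` an admissible exponent in the period of `τ^l p`,
which is `0`. Thus the orbit of a bad polynomial never returns to itself. -/
theorem IsBad.eq_of_associated (h : IsPiSigmaFieldExt σF σ) {τ : RingAut F[X]}
    (hτ : ∀ p, toRat (τ p) = σ (toRat p)) (hdeg : ∀ p, (τ p).natDegree = p.natDegree) {d : ℕ}
    {p : F[X]} (hp : IsBad σ d p) {k l : ℤ} (hkl : Associated ((τ ^ k) p) ((τ ^ l) p)) :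
    k = l := by
  wlog hlt : l < k generalizing k l
  · by_contra hne
    exact hne (this hkl.symm (lt_of_le_of_ne (not_lt.1 hlt) hne)).symm
  exfalso
  have hb := inBase_div_of_associated (hp.zpow h hτ hdeg l).irreducible.ne_zero hkl
  have hper := (hp.zpow h hτ hdeg l).period_eq_zero
  rw [period_eq_zero_iff] at hper
  refine hper (k - l).toNat (by omega) ?_
  convert hb using 2
  rw [toRat_zpow hτ, toRat_zpow hτ, ← zpow_natCast, ← RingAut.mul_apply, ← zpow_add]
  congr 2
  omega

/-- The local ring of `F[x]` at an irreducible polynomial `p`, as a subring of `F(x)`. -/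
def localRing (p : F[X]) (hp : Irreducible p) : Subring (RatFunc F) where
  carrier := {y | ∃ a b : F[X], ¬ p ∣ b ∧ y = toRat a / toRat b}
  one_mem' := ⟨1, 1, hp.prime.not_dvd_one, by simp⟩
  zero_mem' := ⟨0, 1, hp.prime.not_dvd_one, by simp⟩
  mul_mem' := by
    rintro _ _ ⟨a, b, hb, rfl⟩ ⟨a', b', hb', rfl⟩
    refine ⟨a * a', b * b', fun hd => (hp.prime.dvd_or_dvd hd).elim hb hb', ?_⟩
    rw [div_mul_div_comm, toRat_mul, toRat_mul]
  add_mem' := by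
    rintro _ _ ⟨a, b, hb, rfl⟩ ⟨a', b', hb', rfl⟩
    have h0 : toRat b ≠ 0 := by
      rintro h
      exact hb (by simp [toRat_injective (h.trans (map_zero _).symm)])
    have h0' : toRat b' ≠ 0 := by
      rintro h
      exact hb' (by simp [toRat_injective (h.trans (map_zero _).symm)])
    refine ⟨a * b' + b * a', b * b', fun hd => (hp.prime.dvd_or_dvd hd).elim hb hb', ?_⟩
    rw [div_add_div _ _ h0 h0']
    simp only [toRat_mul, toRat_add]
  neg_mem' := by
    rintro _ ⟨a, b, hb, rfl⟩
    exact ⟨-a, b, hb, by rw [toRat_neg, neg_div]⟩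

variable {p : F[X]} (hp : Irreducible p)

theorem mem_localRing_iff {y : RatFunc F} : y ∈ localRing p hp ↔ ¬ p ∣ y.denom := by
  constructor
  · rintro ⟨a, b, hb, rfl⟩ hd
    exact hb (hd.trans (RatFunc.denom_div_dvd a b))
  · exact fun hd => ⟨y.num, y.denom, hd, (RatFunc.num_div_denom y).symm⟩

theorem toRat_mem_localRing (a : F[X]) : toRat a ∈ localRing p hp :=
  ⟨a, 1, hp.prime.not_dvd_one, by simp⟩

theorem inv_toRat_mem_localRing {b : F[X]} (hb : ¬ p ∣ b) : (toRat b)⁻¹ ∈ localRing p hp :=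
  ⟨1, b, hb, by simp⟩

theorem C_mem_localRing (a : F) : RatFunc.C a ∈ localRing p hp := by
  simpa using toRat_mem_localRing hp (C a)

theorem map_mem_localRing {σ' : RingAut (RatFunc F)} {τ' : RingAut F[X]}
    (hτ : ∀ p, toRat (τ' p) = σ' (toRat p)) (hp' : Irreducible (τ' p)) {y : RatFunc F}
    (hy : y ∈ localRing p hp) : σ' y ∈ localRing (τ' p) hp' := by
  obtain ⟨a, b, hb, rfl⟩ := hy
  exact ⟨τ' a, τ' b, by rwa [map_dvd_iff], by rw [map_div₀, hτ, hτ]⟩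

/-- A root of unity is integral over the integrally closed ring `F[x]`, hence a polynomial. -/
theorem mem_localRing_of_root_of_unity {u : RatFunc F} {k : ℕ} (hk : 0 < k) (hu : u ^ k = 1) :
    u ∈ localRing p hp := by
  have hint : IsIntegral F[X] u := by
    refine ⟨X ^ k - 1, ?_, by simp [hu]⟩
    simpa using monic_X_pow_sub_C (1 : F[X]) hk.ne'
  obtain ⟨a, rfl⟩ := IsIntegrallyClosed.algebraMap_eq_of_integral hint
  exact toRat_mem_localRing hp a

theorem XDegreeLE.mem_localRing {d : ℕ} (hp : IsBad σ d p) {u : RatFunc F}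
    (h : XDegreeLE σ d u) : u ∈ localRing p hp.irreducible :=
  (mem_localRing_iff _).2 fun hd =>
    absurd (h p hp.irreducible (Or.inr hd) hp.period_eq_zero) (not_le.2 hp.lt_natDegree)

theorem XDegreeLE.inv_mem_localRing {d : ℕ} (hp : IsBad σ d p) {u : RatFunc F}
    (h : XDegreeLE σ d u) : u⁻¹ ∈ localRing p hp.irreducible :=
  ⟨u.denom, u.num, fun hd =>
    absurd (h p hp.irreducible (Or.inl hd) hp.period_eq_zero) (not_le.2 hp.lt_natDegree), by
    conv_lhs => rw [← RatFunc.num_div_denom u, inv_div]⟩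

theorem xDegreeLE_toRat_iff {d : ℕ} {b : F[X]} :
    XDegreeLE σ d (toRat b) ↔ ∀ p, IsBad σ d p → ¬ p ∣ b := by
  constructor
  · intro h p hp hd
    exact absurd (h p hp.irreducible (Or.inl (by rwa [RatFunc.num_algebraMap])) hp.period_eq_zero)
      (not_le.2 hp.lt_natDegree)
  · intro h p hp hd hper
    by_contra hlt
    rw [RatFunc.num_algebraMap, RatFunc.denom_algebraMap] at hd
    exact h p ⟨hp, hper, not_le.1 hlt⟩ (hd.resolve_right hp.prime.not_dvd_one)

/-- A proper fraction with denominator a power of `p` that is regular at `p` vanishes. -/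
theorem eq_zero_of_div_pow_mem_localRing {a : F[X]} {k : ℕ}
    (hdeg : a.degree < ((p.natDegree * k : ℕ) : WithBot ℕ))
    (h : (toRat (p ^ k))⁻¹ * toRat a ∈ localRing p hp) : a = 0 := by
  obtain ⟨a', b, hb, hab⟩ := h
  have hb0 : b ≠ 0 := by
    rintro rfl
    exact hb (dvd_zero p)
  have hpk : p ^ k ≠ 0 := pow_ne_zero _ hp.ne_zero
  have hb0' : toRat b ≠ 0 := fun h => hb0 (toRat_injective (h.trans (map_zero _).symm))
  have hpk' : toRat (p ^ k) ≠ 0 := fun h => hpk (toRat_injective (h.trans (map_zero _).symm))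
  have heq : a * b = p ^ k * a' := by
    apply toRat_injective
    rw [toRat_mul, toRat_mul]
    rw [inv_mul_eq_div, div_eq_div_iff hpk' hb0'] at hab
    rw [hab, mul_comm]
  -- Regularity at `p` forces `p ^ k` to divide the numerator, which properness allows only for
  -- zero.
  have hcop : IsCoprime (p ^ k) b := ((hp.coprime_iff_not_dvd).2 hb).pow_left
  have hdvd : p ^ k ∣ a := hcop.dvd_of_dvd_mul_right ⟨a', heq⟩
  refine Polynomial.eq_zero_of_dvd_of_degree_lt hdvd ?_
  rwa [degree_eq_natDegree hpk, natDegree_pow, mul_comm]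

end BaseField

/-! ### The action of `σ` on the levels over subrings of the ground ring -/

theorem powerProduct_mul_neg {E : Type*} [CommRing E] {e : ℕ} {t : Fin e → E} {m : Fin e → ℤ}
    (h : ∀ j, m j ≠ 0 → IsUnit (t j)) : powerProduct t m * powerProduct t (-m) = 1 := by
  rw [powerProduct, powerProduct, ← Finset.prod_mul_distrib]
  refine Finset.prod_eq_one fun j _ => ?_
  by_cases hj : m j = 0
  · simp [hj]
  · obtain ⟨u, hu⟩ := h j hj
    rw [← hu, ipow_unit, ipow_unit, ← Units.val_mul, ← zpow_add]
    simp

theorem PowerLaw.isUnit {E : Type*} [CommRing E] {k : MonomialKind} {t : E} (h : PowerLaw k t)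
    (hk : k ≠ .sigma) : IsUnit t := by
  cases k with
  | root ν => exact IsUnit.of_pow_eq_one h.2 (by have := h.1; omega)
  | pi => exact h
  | sigma => exact absurd rfl hk

section Action

variable {A E : Type*} [CommRing A] [CommRing E] [Algebra A E] {e : ℕ}
  {kind : Fin e → MonomialKind} {t : Fin e → E} {σA : RingAut A} {σE : RingAut E}

/-- The data that define `σ(tᵢ)` have coefficients in `O`. -/
structure IsDefinedOver (O : Subring A) (σE : RingAut E) (kind : Fin e → MonomialKind)
    (t : Fin e → E) (i : Fin e) : Prop where
  sigma : kind i = .sigma → σE (t i) - t i ∈ level O kind t i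
  unit : kind i ≠ .sigma → ∃ (u v : A) (m : Fin e → ℤ), u ∈ O ∧ v ∈ O ∧ u * v = 1 ∧
    (∀ j, i ≤ j ∨ kind j = .sigma → m j = 0) ∧ σE (t i) = (u • powerProduct t m) * t i

/-- The multiplier of an R- or Π-monomial and its inverse both lie in the lower level over `O`; the
inverse is needed for the action on `tᵢ⁻¹` and for `σ⁻¹`. -/
theorem IsDefinedOver.exists_factor {O : Subring A} {i : Fin e}
    (h : IsDefinedOver O σE kind t i) (hpl : ∀ i, PowerLaw (kind i) (t i))
    (hk : kind i ≠ .sigma) :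
    ∃ x y : E, x ∈ level O kind t i ∧ y ∈ level O kind t i ∧ x * y = 1 ∧ σE (t i) = x * t i ∧
      σE (Ring.inverse (t i)) = y * Ring.inverse (t i) := by
  obtain ⟨u, v, m, hu, hv, huv, hm, hσ⟩ := h.unit hk
  have hm0 : ∀ j : Fin e, (i : ℕ) ≤ j → m j = 0 := fun j hj => hm j (Or.inl hj)
  have hms : ∀ j, kind j = .sigma → m j = 0 := fun j hj => hm j (Or.inr hj)
  have hmem : ∀ {w : A}, w ∈ O → ∀ {n : Fin e → ℤ}, (∀ j : Fin e, (i : ℕ) ≤ j → n j = 0) →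
      (∀ j, kind j = .sigma → n j = 0) → w • powerProduct t n ∈ level O kind t i :=
    fun {w} hw {n} h1 h2 => Subalgebra.smul_mem (level O kind t i)
      (powerProduct_mem_level hpl h1 fun j hj => (h2 j hj).ge) (⟨w, hw⟩ : O)
  have hxy : (u • powerProduct t m) * (v • powerProduct t (-m)) = 1 := by
    rw [smul_mul_smul_comm, huv, one_smul]
    exact powerProduct_mul_neg fun j hj => (hpl j).isUnit fun hs => hj (hms j hs)
  refine ⟨u • powerProduct t m, v • powerProduct t (-m), hmem hu hm0 hms,
    hmem hv (fun j hj => by simp [hm0 j hj]) (fun j hj => by simp [hms j hj]), hxy, hσ, ?_⟩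
  have hti : Ring.inverse (t i) * t i = 1 := Ring.inverse_mul_cancel _ ((hpl i).isUnit hk)
  have h1 : σE (Ring.inverse (t i)) * σE (t i) = 1 := by rw [← map_mul, hti, map_one]
  have hunit : IsUnit (σE (t i)) := ((hpl i).isUnit hk).map σE
  apply hunit.mul_right_cancel
  rw [h1, hσ]
  linear_combination (-1 : E) * hxy * (Ring.inverse (t i) * t i) - hti

theorem map_mem_level {O O' : Subring A}
    (hext : ∀ a : A, σE (algebraMap A E a) = algebraMap A E (σA a))
    (hpl : ∀ i, PowerLaw (kind i) (t i)) (h : ∀ i, IsDefinedOver O' σE kind t i)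
    (hO : ∀ a ∈ O, σA a ∈ O') {y : E} (hy : y ∈ level O kind t e) :
    σE y ∈ level O' kind t e := by
  induction hy using Algebra.adjoin_induction with
  | mem y hy =>
    obtain ⟨j, -, rfl | ⟨hk, rfl⟩⟩ := hy
    · by_cases hk : kind j = .sigma
      · have := level_mono j.2.le ((h j).sigma hk)
        simpa using add_mem this (monomial_mem_level j.2)
      · obtain ⟨x, y, hx, -, -, hσ, -⟩ := (h j).exists_factor hpl hk
        rw [hσ]
        exact mul_mem (level_mono j.2.le hx) (monomial_mem_level j.2)
    · have hk' : kind j ≠ .sigma := by simp [hk]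
      obtain ⟨x, y, -, hy, -, -, hσ⟩ := (h j).exists_factor hpl hk'
      rw [hσ]
      exact mul_mem (level_mono j.2.le hy) (inverse_mem_level hpl j.2 hk')
  | algebraMap r =>
    change σE (algebraMap A E r) ∈ _
    rw [hext]
    exact Subalgebra.algebraMap_mem (level O' kind t e) (⟨σA r, hO r r.2⟩ : O')
  | add x y _ _ hx hy => rw [map_add]; exact add_mem hx hy
  | mul x y _ _ hx hy => rw [map_mul]; exact mul_mem hx hy

/-- Applying `σ⁻¹` to the defining relations gives `σ⁻¹(t) = t - σ⁻¹(σ(t) - t)` or `σ⁻¹(t) = σ⁻¹(y)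
t` with `y` inverse to the multiplier. The argument of `σ⁻¹` on the right lies in a lower level,
whence the strong induction. -/
theorem symm_map_mem_level {O O' : Subring A}
    (hext : ∀ a : A, σE (algebraMap A E a) = algebraMap A E (σA a))
    (hpl : ∀ i, PowerLaw (kind i) (t i)) (h : ∀ i, IsDefinedOver O' σE kind t i)
    (hO : ∀ a ∈ O', σA.symm a ∈ O) (i : ℕ) {y : E} (hy : y ∈ level O' kind t i) :
    σE.symm y ∈ level O kind t e := by
  induction i using Nat.strong_induction_on generalizing y with
  | _ i ih =>
  induction hy using Algebra.adjoin_induction with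
  | mem y hy =>
    obtain ⟨j, hj, rfl | ⟨hk, rfl⟩⟩ := hy
    · by_cases hk : kind j = .sigma
      · have h1 : σE.symm (t j) = t j - σE.symm (σE (t j) - t j) := by simp
        rw [h1]
        exact sub_mem (monomial_mem_level j.2) (ih j hj ((h j).sigma hk))
      · obtain ⟨x, y, -, hy, hxy, hσ, -⟩ := (h j).exists_factor hpl hk
        have h1 : σE.symm (t j) = σE.symm y * t j := by
          apply σE.injective
          rw [map_mul, hσ]
          simp only [RingEquiv.apply_symm_apply]
          linear_combination (-t j) * hxy
        rw [h1]
        exact mul_mem (ih j hj hy) (monomial_mem_level j.2)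
    · have hk' : kind j ≠ .sigma := by simp [hk]
      obtain ⟨x, y, hx, -, hxy, -, hσ⟩ := (h j).exists_factor hpl hk'
      have h1 : σE.symm (Ring.inverse (t j)) = σE.symm x * Ring.inverse (t j) := by
        apply σE.injective
        rw [map_mul, hσ]
        simp only [RingEquiv.apply_symm_apply]
        linear_combination (-Ring.inverse (t j)) * hxy
      rw [h1]
      exact mul_mem (ih j hj hx) (inverse_mem_level hpl j.2 hk')
  | algebraMap r =>
    have h1 : σE.symm (algebraMap A E r) = algebraMap A E (σA.symm r) := by
      apply σE.injective
      rw [hext]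
      simp
    change σE.symm (algebraMap A E r) ∈ _
    rw [h1]
    exact Subalgebra.algebraMap_mem (level O kind t e) (⟨σA.symm r, hO r r.2⟩ : O)
  | add x y _ _ hx hy => rw [map_add]; exact add_mem hx hy
  | mul x y _ _ hx hy => rw [map_mul]; exact mul_mem hx hy

end Action

/-! ### Denominators -/

section Denominators

variable {F : Type*} [Field F] {σF : RingAut F} {σ : RingAut (RatFunc F)} {E : Type*} [CommRing E]
  [Algebra (RatFunc F) E] {σE : RingAut E} {e : ℕ} {kind : Fin e → MonomialKind} {t : Fin e → E}
  {d : ℕ}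

theorem Irreducible.dvd_den_iff {p : F[X]} (hp : Irreducible p) {f : E} :
    p ∣ den F kind t f ↔ ∃ n, p ∣ (coeffs (RatFunc F) kind t f n).denom := by
  classical
  let _ : NormalizedGCDMonoid F[X] := UniqueFactorizationMonoid.toNormalizedGCDMonoid F[X]
  constructor
  · intro h
    have h1 : den F kind t f ∣ ∏ n ∈ (coeffs (RatFunc F) kind t f).support,
        (coeffs (RatFunc F) kind t f n).denom :=
      Finset.lcm_dvd fun n hn =>
        Finset.dvd_prod_of_mem (fun n => (coeffs (RatFunc F) kind t f n).denom) hn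
    obtain ⟨n, -, hn⟩ := (hp.prime.dvd_finsetProd_iff _).1 (h.trans h1)
    exact ⟨n, hn⟩
  · rintro ⟨n, hn⟩
    by_cases hs : n ∈ (coeffs (RatFunc F) kind t f).support
    · exact hn.trans (Finset.dvd_lcm (f := fun n => (coeffs (RatFunc F) kind t f n).denom) hs)
    · rw [Finsupp.notMem_support_iff.1 hs, RatFunc.denom_zero] at hn
      exact absurd hn hp.prime.not_dvd_one

theorem den_ne_zero (f : E) : den F kind t f ≠ 0 := by
  classical
  let _ : NormalizedGCDMonoid F[X] := UniqueFactorizationMonoid.toNormalizedGCDMonoid F[X]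
  have h1 : den F kind t f ∣ ∏ n ∈ (coeffs (RatFunc F) kind t f).support,
      (coeffs (RatFunc F) kind t f n).denom :=
    Finset.lcm_dvd fun n hn =>
      Finset.dvd_prod_of_mem (fun n => (coeffs (RatFunc F) kind t f n).denom) hn
  exact ne_zero_of_dvd_ne_zero (Finset.prod_ne_zero_iff.2 fun n _ => RatFunc.denom_ne_zero _) h1

theorem IsRPiSigmaExt.not_dvd_den_iff (h : IsRPiSigmaExt σ σE kind t) {p : F[X]}
    (hp : Irreducible p) {i : ℕ} {f : E} (hf : f ∈ level (RatFunc F) kind t i) :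
    ¬ p ∣ den F kind t f ↔ f ∈ level (localRing p hp) kind t i := by
  rw [h.mem_level_subring _ hf, Irreducible.dvd_den_iff hp, not_exists]
  simp only [mem_localRing_iff]

/-- `f` has a denominator of `x`-degree `≤ d` if and only if it is regular at all polynomials that
the bound forbids. -/
theorem IsRPiSigmaExt.xDegreeLE_den_iff (h : IsRPiSigmaExt σ σE kind t) {i : ℕ} {f : E}
    (hf : f ∈ level (RatFunc F) kind t i) :
    XDegreeLE σ d (toRat (den F kind t f)) ↔
      ∀ p (hp : IsBad σ d p), f ∈ level (localRing p hp.irreducible) kind t i := by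
  rw [xDegreeLE_toRat_iff]
  exact forall₂_congr fun p hp => h.not_dvd_den_iff hp.irreducible hf

/-- For a Π-monomial the degree bound covers numerator and denominator of `u`, so both `u` and `u⁻¹`
are regular at `p`. For an R-monomial both are roots of unity. -/
theorem IsSimpleRPiSigmaExtXDegreeLE.isDefinedOver
    (h : IsSimpleRPiSigmaExtXDegreeLE σ σE kind t d) {p : F[X]} (hp : IsBad σ d p) (i : Fin e) :
    IsDefinedOver (localRing p hp.irreducible) σE kind t i where
  sigma hk := by
    have hx := h.xDegreeLE i
    have hm := h.isExt.monomial i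
    rw [hk] at hx hm
    exact (h.isExt.xDegreeLE_den_iff hm.2).1 hx p hp
  unit hk := by
    rcases hki : kind i with ν | _ | _
    · have hs := h.simple i
      rw [hki] at hs
      obtain ⟨u, m, ⟨k, hk, hu⟩, hm, hσ⟩ := hs
      refine ⟨u, (u⁻¹ : (RatFunc F)ˣ), m, mem_localRing_of_root_of_unity _ hk ?_,
        mem_localRing_of_root_of_unity _ hk ?_, u.mul_inv, fun j hj => hm j (by tauto), hσ⟩
      · rw [← Units.val_pow_eq_pow_val, hu, Units.val_one]
      · rw [← Units.val_pow_eq_pow_val, inv_pow, hu, inv_one, Units.val_one]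
    · have hx := h.xDegreeLE i
      rw [hki] at hx
      obtain ⟨u, m, hu, hud, hm, hσ⟩ := hx
      exact ⟨u, u⁻¹, m, hud.mem_localRing hp, hud.inv_mem_localRing hp, mul_inv_cancel₀ hu, hm, hσ⟩
    · exact absurd hki hk

/-- Poles move along the orbit with `σ`, in both directions. The equation `p' = τ p` is a hypothesis
so that powers of `τ` written in different forms can be inserted. -/
theorem IsSimpleRPiSigmaExtXDegreeLE.map_mem_iff
    (h : IsSimpleRPiSigmaExtXDegreeLE σ σE kind t d) {τ : RingAut F[X]}
    (hτ : ∀ p, toRat (τ p) = σ (toRat p)) {p p' : F[X]} (hpp' : p' = τ p) (hp : IsBad σ d p)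
    (hp' : IsBad σ d p') {y : E} :
    σE y ∈ level (localRing p' hp'.irreducible) kind t e ↔
      y ∈ level (localRing p hp.irreducible) kind t e := by
  subst hpp'
  constructor
  · intro hy
    have hback := symm_map_mem_level (O := localRing p hp.irreducible) h.isExt.extends_base
      h.isExt.powerLaw (h.isDefinedOver hp') ?_ e hy
    · simpa using hback
    · rintro _ ⟨a, b, hb, rfl⟩
      have hs : ∀ a, σ.symm (toRat a) = toRat (τ.symm a) := fun a => by
        apply σ.injective
        rw [← hτ]
        simp
      refine ⟨τ.symm a, τ.symm b, fun hd => hb ?_, by rw [map_div₀, hs, hs]⟩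
      simpa using map_dvd τ hd
  · exact map_mem_level h.isExt.extends_base h.isExt.powerLaw (h.isDefinedOver hp')
      fun a ha => map_mem_localRing _ hτ _ ha

end Denominators

/-! ### Telescoping -/

section Telescoping

variable {F : Type*} [Field F] {σF : RingAut F} {σ : RingAut (RatFunc F)} {E : Type*} [CommRing E]
  [Algebra (RatFunc F) E] {σE : RingAut E} {e : ℕ} {kind : Fin e → MonomialKind} {t : Fin e → E}
  {d : ℕ}

theorem InBase.mul {x y : RatFunc F} (hx : InBase x) (hy : InBase y) : InBase (x * y) := by
  obtain ⟨a, rfl⟩ := hx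
  obtain ⟨b, rfl⟩ := hy
  exact ⟨a * b, map_mul _ _ _⟩

/-- Elements of `F[X]` associated to members of one orbit differ by `σ^(l-k)` up to factors in `F`.
-/
theorem sigmaEquiv_of_associated (h : IsPiSigmaFieldExt σF σ) {τ : RingAut F[X]}
    (hτ : ∀ p, toRat (τ p) = σ (toRat p)) {p q q' : F[X]} (hp : p ≠ 0) (hq' : q' ≠ 0) {k l : ℤ}
    (hk : Associated ((τ ^ k) p) q) (hl : Associated ((τ ^ l) p) q') : SigmaEquiv σ q q' := by
  refine ⟨l - k, ?_⟩
  have hpk : ∀ k : ℤ, (τ ^ k) p ≠ 0 := fun k => by simpa using hp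
  have h1 := inBase_zpow_apply h (l - k) (inBase_div_of_associated (hpk k) hk.symm)
  have h2 := inBase_div_of_associated hq' hl
  convert h1.mul h2 using 1
  rw [map_div₀, ← toRat_zpow hτ (l - k) ((τ ^ k) p), ← RingAut.mul_apply, ← zpow_add,
    sub_add_cancel, div_mul_div_cancel₀]
  exact fun h0 => hpk l (toRat_injective (h0.trans (map_zero _).symm))

/-- If the denominator of `σ(g) - g` contains at most one forbidden factor from each `σ`-orbit,
then the denominator of `g` contains none. -/
theorem IsSimpleRPiSigmaExtXDegreeLE.mem_level_of_telescoping (hσ : IsPiSigmaFieldExt σF σ)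
    (h : IsSimpleRPiSigmaExtXDegreeLE σ σE kind t d) {T : Set F[X]} (hT0 : ∀ q ∈ T, q ≠ 0)
    (hT : ∀ q ∈ T, ∀ q' ∈ T, SigmaEquiv σ q q' → q = q') {g : E}
    (hg : ∀ p (hp : IsBad σ d p),
      σE g - g ∉ level (localRing p hp.irreducible) kind t e → ∃ q ∈ T, Associated p q)
    {p : F[X]} (hp : IsBad σ d p) : g ∈ level (localRing p hp.irreducible) kind t e := by
  classical
  obtain ⟨τ, hτ, hdeg⟩ := hσ.exists_polynomialAut
  have hbad : ∀ k : ℤ, IsBad σ d ((τ ^ k) p) := hp.zpow hσ hτ hdeg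
  -- The positions in the orbit of `p` at which `g` has a pole.
  set K : Set ℤ :=
    {k | g ∉ level (localRing ((τ ^ k) p) (hbad k).irreducible) kind t e} with hK
  have hKdvd : ∀ k ∈ K, (τ ^ k) p ∣ den F kind t g := fun k hk => by
    by_contra hnd
    exact hk ((h.isExt.not_dvd_den_iff _ (h.isExt.mem_level_length g)).1 hnd)
  -- Distinct positions give non-associated irreducible factors of the nonzero polynomial `den(g)`,
  -- which has finitely many.
  have hKfin : K.Finite := by
    choose! r hr using fun k (hk : k ∈ K) =>
      UniqueFactorizationMonoid.exists_mem_normalizedFactors_of_dvd (den_ne_zero (F := F) g)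
        (hbad k).irreducible (hKdvd k hk)
    refine Set.Finite.of_finite_image (f := r) (Set.Finite.subset (Finset.finite_toSet
      (UniqueFactorizationMonoid.normalizedFactors (den F kind t g)).toFinset) ?_) ?_
    · rintro _ ⟨k, hk, rfl⟩
      exact Multiset.mem_toFinset.2 (hr k hk).1
    · intro k hk l hl hkl
      have h1 := (hr k hk).2
      have h2 := (hr l hl).2
      rw [hkl] at h1
      exact hp.eq_of_associated hσ hτ hdeg (h1.trans h2.symm)
  have hstep : ∀ k l : ℤ, l = k + 1 →
      (σE g ∈ level (localRing ((τ ^ l) p) (hbad l).irreducible) kind t e ↔ k ∉ K) :=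
      fun k l hl => by
    rw [hK, Set.mem_ofPred_eq, not_not]
    refine h.map_mem_iff hτ ?_ (hbad k) (hbad l)
    rw [hl, add_comm, zpow_one_add, RingAut.mul_apply]
  by_contra hgp
  have hne : K.Nonempty := by
    -- The local ring depends on `p`, so `τ^0 p = p` is used by substitution rather than by
    -- rewriting.
    have : ∀ p' (hp' : Irreducible p'), p' = p → g ∉ level (localRing p' hp') kind t e := by
      rintro _ _ rfl
      exact hgp
    exact ⟨0, this _ _ (by simp)⟩
  obtain ⟨k, hk, hkmax⟩ := Set.exists_max_image K id hKfin hne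
  obtain ⟨l, hl, hlmin⟩ := Set.exists_min_image K id hKfin hne
  simp only [id] at hkmax hlmin
  -- Just above the last pole of `g`, only `σ(g)` has a pole.
  obtain ⟨q, hq, hpq⟩ := hg _ (hbad (k + 1)) fun hmem => by
    have hk1 : k + 1 ∉ K := fun hh => by have := hkmax _ hh; omega
    rw [hK, Set.mem_ofPred_eq, not_not] at hk1
    exact (hstep k _ rfl).1 (by simpa using add_mem hmem hk1) hk
  -- At the first pole of `g`, `σ(g)` is regular.
  obtain ⟨q', hq', hpq'⟩ := hg _ (hbad l) fun hmem => by
    have hl1 : l - 1 ∉ K := fun hh => by have := hlmin _ hh; omega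
    have := (hstep (l - 1) l (by ring)).2 hl1
    exact hl (by simpa using sub_mem this hmem)
  have hqq' := hT q hq q' hq'
    (sigmaEquiv_of_associated hσ hτ hp.irreducible.ne_zero (hT0 q' hq') hpq hpq')
  subst hqq'
  -- Both poles are now associated to the same element of `T`, so `k + 1 = l`, against `l ≤ k`.
  have := hp.eq_of_associated hσ hτ hdeg (hpq.trans hpq'.symm)
  have := hkmax l hl
  omega

theorem IsXPoly.mem_level (h : IsRPiSigmaExt σ σE kind t) {y : E} (hy : IsXPoly F kind t y)
    {p : F[X]} (hp : Irreducible p) : y ∈ level (localRing p hp) kind t e := by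
  rw [h.mem_level_subring _ (h.mem_level_length y)]
  intro n
  obtain ⟨a, ha⟩ := hy n
  rw [ha]
  exact toRat_mem_localRing hp a

theorem IsXPoly.quot_mem_level (h : IsRPiSigmaExt σ σE kind t) {y : E} (hy : IsXPoly F kind t y)
    {p b : F[X]} (hp : Irreducible p) (hb : ¬ p ∣ b) :
    quot y b ∈ level (localRing p hp) kind t e :=
  Subalgebra.smul_mem (level (localRing p hp) kind t e) (hy.mem_level h hp)
    (⟨_, inv_toRat_mem_localRing hp hb⟩ : localRing p hp)

theorem eq_zero_of_quot_pow_mem_level (h : IsRPiSigmaExt σ σE kind t) {y : E}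
    (hy : IsXPoly F kind t y) {p : F[X]} (hp : Irreducible p) {k : ℕ}
    (hdeg : degX F kind t y < ((p.natDegree * k : ℕ) : WithBot ℕ))
    (hmem : quot y (p ^ k) ∈ level (localRing p hp) kind t e) : y = 0 := by
  refine h.eq_zero_of_coeffs_eq_zero fun n => ?_
  rw [h.mem_level_subring _ (h.mem_level_length _)] at hmem
  obtain ⟨a, ha⟩ := hy n
  by_cases hn : n ∈ (coeffs (RatFunc F) kind t y).support
  · have hn' : coeffs (RatFunc F) kind t (quot y (p ^ k)) n = (toRat (p ^ k))⁻¹ * toRat a := by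
      rw [← ha]
      exact DFunLike.congr_fun (h.coeffsLinear.map_smul (toRat (p ^ k))⁻¹ y) n
    have hmem' := hmem n
    rw [hn'] at hmem'
    have hle := Finset.le_sup (f := fun n => (coeffs (RatFunc F) kind t y n).num.degree) hn
    simp only [ha, RatFunc.num_algebraMap] at hle
    rw [ha, eq_zero_of_div_pow_mem_localRing hp (hle.trans_lt hdeg) hmem', toRat, map_zero]
  · exact Finsupp.notMem_support_iff.1 hn

/-- The `σ`-reduced numerators of a telescoping element vanish. -/
theorem IsSimpleRPiSigmaExtXDegreeLE.numerators_eq_zero (hσ : IsPiSigmaFieldExt σF σ)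
    (h : IsSimpleRPiSigmaExtXDegreeLE σ σE kind t d) {r : ℕ} {q : Fin r → F[X]}
    (hq : Function.Injective q) (hQ : IsDXSet σ d (Set.range q)) {N : Fin r → E} {μ : Fin r → ℕ}
    (hN : ∀ j, IsXPoly F kind t (N j))
    (hdeg : ∀ j, degX F kind t (N j) < (((q j).natDegree * μ j : ℕ) : WithBot ℕ)) {w g : E}
    (hw : ∀ p (hp : IsBad σ d p), w ∈ level (localRing p hp.irreducible) kind t e)
    (hg : σE g - g = (∑ j, quot (N j) (q j ^ μ j)) + w) (j : Fin r) : N j = 0 := by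
  have hqbad : ∀ j, IsBad σ d (q j) := fun j =>
    ⟨hQ.irreducible _ ⟨j, rfl⟩, hQ.period_eq_zero _ ⟨j, rfl⟩, hQ.lt_natDegree _ ⟨j, rfl⟩⟩
  have hterm : ∀ p (hp : IsBad σ d p) (i : Fin r), ¬ Associated p (q i) →
      quot (N i) (q i ^ μ i) ∈ level (localRing p hp.irreducible) kind t e :=
    fun p hp i hpi => (hN i).quot_mem_level h.isExt hp.irreducible fun hd =>
      hpi (hp.irreducible.associated_of_dvd (hqbad i).irreducible
        (hp.irreducible.prime.dvd_of_dvd_pow hd))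
  -- The bad poles of the right-hand side lie among the `q i`, which meet each orbit at most once.
  have hall : ∀ p (hp : IsBad σ d p), g ∈ level (localRing p hp.irreducible) kind t e :=
    fun p hp => h.mem_level_of_telescoping hσ (T := Set.range q)
      (fun q' hq' => (hQ.irreducible q' hq').ne_zero)
      (fun q₁ h₁ q₂ h₂ heq => by
        by_contra hne
        exact hQ.coprime q₁ h₁ q₂ h₂ hne heq)
      (fun p hp hnot => by
        by_contra hno
        refine hnot ?_
        rw [hg]
        exact add_mem (sum_mem fun i _ => hterm p hp i fun ha => hno ⟨q i, ⟨i, rfl⟩, ha⟩)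
          (hw p hp)) hp
  obtain ⟨τ, hτ, hdegτ⟩ := hσ.exists_polynomialAut
  -- A pole of `σ(g)` at `q j` would come from a pole of `g` at `τ⁻¹ (q j)`, which is bad too.
  have hσg : σE g ∈ level (localRing (q j) (hqbad j).irreducible) kind t e := by
    have hb : IsBad σ d ((τ ^ (-1 : ℤ)) (q j)) := (hqbad j).zpow hσ hτ hdegτ _
    refine (h.map_mem_iff hτ ?_ hb (hqbad j)).2 (hall _ hb)
    rw [zpow_neg_one]
    exact (τ.apply_symm_apply _).symm
  refine eq_zero_of_quot_pow_mem_level h.isExt (hN j) (hqbad j).irreducible (hdeg j) ?_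
  have hrest : ∑ i ∈ Finset.univ.erase j, quot (N i) (q i ^ μ i) ∈
      level (localRing (q j) (hqbad j).irreducible) kind t e := by
    refine sum_mem fun i hi => hterm _ (hqbad j) i fun ha => ?_
    have := eq_of_monic_of_associated (hQ.monic _ ⟨j, rfl⟩) (hQ.monic _ ⟨i, rfl⟩) ha
    exact Finset.ne_of_mem_erase hi (hq this).symm
  have hsplit : quot (N j) (q j ^ μ j) =
      σE g - g - ∑ i ∈ Finset.univ.erase j, quot (N i) (q i ^ μ i) - w := by
    rw [hg, ← Finset.add_sum_erase _ _ (Finset.mem_univ j)]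
    ring
  rw [hsplit]
  exact sub_mem (sub_mem (sub_mem hσg (hall _ (hqbad j))) hrest) (hw _ (hqbad j))

end Telescoping

/-! ### Adjoining a `Σ`-monomial -/

section SigmaMonomial

/-- The automorphism of `E[X]` that extends `σ` and maps `X` to `X + β`. -/
def sigmaAut {E : Type*} [CommRing E] (σE : RingAut E) (β : E) : RingAut E[X] :=
  (Polynomial.mapEquiv σE).trans (algEquivAevalXAddC β).toRingEquiv

theorem sigmaAut_apply {E : Type*} [CommRing E] (σE : RingAut E) (β : E) (p : E[X]) :
    sigmaAut σE β p = taylor β (p.map (σE : E →+* E)) := by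
  rw [taylor_apply]
  rfl

theorem sigmaAut_C {E : Type*} [CommRing E] (σE : RingAut E) (β a : E) :
    sigmaAut σE β (C a) = C (σE a) := by
  simp [sigmaAut_apply]

theorem sigmaAut_X {E : Type*} [CommRing E] (σE : RingAut E) (β : E) :
    sigmaAut σE β X = X + C β := by
  simp [sigmaAut_apply]

theorem coeff_taylor_of_natDegree_le {R : Type*} [CommRing R] (r : R) {f : R[X]} {n : ℕ}
    (hf : f.natDegree ≤ n + 1) :
    (taylor r f).coeff n = f.coeff n + (n + 1) * f.coeff (n + 1) * r := by
  have hdeg : (hasseDeriv n f).natDegree < 2 :=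
    ((natDegree_hasseDeriv_le f n).trans (by omega : f.natDegree - n ≤ 1)).trans_lt one_lt_two
  rw [taylor_coeff, eval_eq_sum_range' hdeg]
  simp [Finset.sum_range_succ, hasseDeriv_coeff, add_comm 1 n]

/-- For a constant of degree `n + 1`, the top coefficient is a nonzero constant `a`, lying in the
field `A`. The next coefficient `y_n` satisfies `σ(y_n) - y_n = -(n + 1) a β`. In characteristic `0`
the factor `(n + 1) a` can be divided out, and `β` telescopes. -/
theorem sigmaAut_constants {A E : Type*} [Field A] [CharZero A] [CommRing E] [Algebra A E]
    {σA : RingAut A} {σE : RingAut E}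
    (hext : ∀ a : A, σE (algebraMap A E a) = algebraMap A E (σA a))
    (hconst : ∀ y : E, σE y = y → ∃ a : A, σA a = a ∧ algebraMap A E a = y) {β : E}
    (hβ : ¬ ∃ g : E, σE g - g = β) {y : E[X]} (hy : sigmaAut σE β y = y) :
    ∃ a : E, σE a = a ∧ C a = y := by
  rw [sigmaAut_apply] at hy
  have hmap : (y.map (σE : E →+* E)).natDegree ≤ y.natDegree := natDegree_map_le
  rcases hn : y.natDegree with _ | n
  · rw [natDegree_eq_zero] at hn
    obtain ⟨a, rfl⟩ := hn
    exact ⟨a, by simpa using hy, rfl⟩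
  exfalso
  have hcoeff : ∀ k, n ≤ k → σE (y.coeff k) + (k + 1) * σE (y.coeff (k + 1)) * β = y.coeff k :=
    fun k hk => by
      have := coeff_taylor_of_natDegree_le β (hmap.trans (by omega : y.natDegree ≤ k + 1))
      rw [hy, coeff_map, coeff_map] at this
      exact this.symm
  have htop := hcoeff (n + 1) (by omega)
  rw [coeff_eq_zero_of_natDegree_lt (by omega : y.natDegree < n + 1 + 1)] at htop
  simp only [map_zero, mul_zero, zero_mul, add_zero] at htop
  obtain ⟨a, ha, hay⟩ := hconst _ htop
  have ha0 : a ≠ 0 := by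
    rintro rfl
    have : y.leadingCoeff = 0 := by rw [leadingCoeff, hn, ← hay, map_zero]
    rw [leadingCoeff_eq_zero] at this
    simp [this] at hn
  set b : A := (((n : A) + 1) * a)⁻¹ with hb
  have hb1 : ((n : A) + 1) * a * b = 1 :=
    mul_inv_cancel₀ (mul_ne_zero (by exact_mod_cast n.succ_ne_zero) ha0)
  have hσb : σE (algebraMap A E b) = algebraMap A E b := by
    rw [hext, hb, map_inv₀, map_mul, ha]
    simp
  have hb1' := congrArg (algebraMap A E) hb1
  simp only [map_mul, map_add, map_natCast, map_one] at hb1'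
  refine hβ ⟨-(y.coeff n * algebraMap A E b), ?_⟩
  have hlow := hcoeff n le_rfl
  rw [htop, ← hay] at hlow
  rw [map_neg, map_mul, hσb]
  linear_combination (-algebraMap A E b) * hlow + β * hb1'

/-- The hypotheses identify `B` with the constant polynomials, over which the variable is
transcendental. -/
theorem transcendental_X_of_range {A E : Type*} [CommRing A] [CommRing E] [Algebra A E]
    (B : Subalgebra A E[X]) (h1 : ∀ b ∈ B, ∃ a, C a = b) (h2 : ∀ a, C a ∈ B) :
    Transcendental B (X : E[X]) := by
  let f : E →+* B := (C : E →+* E[X]).codRestrict B h2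
  have hf : Function.Surjective f := fun b => by
    obtain ⟨a, ha⟩ := h1 b b.2
    exact ⟨a, Subtype.ext ha⟩
  have := Transcendental.ringHom_of_comp_eq (S := B) (B := E[X]) f (RingHom.id E[X])
    (transcendental_X E) hf Function.injective_id (by ext1 a; rfl)
  simpa using this

theorem isRPiSigmaExt_polynomial {E : Type*} [CommRing E] {σE : RingAut E} {σ' : RingAut E[X]}
    {β : E} (hC : ∀ a, σ' (C a) = C (σE a)) (hX : σ' X - X = C β)
    (hconst : ∀ y, σ' y = y → ∃ a, σE a = a ∧ C a = y) :
    IsRPiSigmaExt σE σ' (fun _ : Fin 1 => MonomialKind.sigma) (fun _ => (X : E[X])) where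
  injective := C_injective
  extends_base := hC
  monomial i := by
    have hbot : level E (fun _ : Fin 1 => MonomialKind.sigma) (fun _ => (X : E[X])) i = ⊥ := by
      rw [level, ← Algebra.adjoin_empty]
      congr 1
      ext y
      simp only [Set.mem_empty_iff_false, iff_false]
      rintro ⟨j, hj, -⟩
      omega
    rw [hbot]
    refine ⟨transcendental_X_of_range _ (fun b hb => Algebra.mem_bot.1 hb)
      fun a => Subalgebra.algebraMap_mem _ a, ?_⟩
    rw [hX]
    exact Subalgebra.algebraMap_mem _ β
  generates := by
    rw [eq_top_iff, ← adjoin_X]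
    refine Algebra.adjoin_mono ?_
    rintro _ rfl
    exact ⟨0, by simp, Or.inl rfl⟩
  constants_eq := hconst

end SigmaMonomial

/-! ### Transfer of a tower along an injection -/

section Transfer

variable {A E E' : Type*} [CommRing A] [CommRing E] [CommRing E'] [Algebra A E] [Algebra A E']

/-- By injectivity `B` is isomorphic to its image, and `ψ x` satisfies exactly the polynomial
relations of `x`. -/
theorem IsMonomial.map {σ : RingAut E} {σ' : RingAut E'} (ψ : E →ₐ[A] E')
    (hψ : Function.Injective ψ) (hσ : ∀ y, σ' (ψ y) = ψ (σ y)) {B : Subalgebra A E} {x : E}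
    {k : MonomialKind} (h : IsMonomial σ B x k) : IsMonomial σ' (B.map ψ) (ψ x) k := by
  let ε : B ≃ₐ[A] B.map ψ := B.equivMapOfInjective ψ hψ
  have hε : ∀ b : B, ((ε b : B.map ψ) : E') = ψ b := fun b => rfl
  have htr : Transcendental B x → Transcendental (B.map ψ) (ψ x) := fun ht =>
    Transcendental.ringHom_of_comp_eq (R := B) (S := B.map ψ) ε ψ ht ε.surjective hψ rfl
  have hunit : ∀ α : Bˣ, σ x = ((α : B) : E) * x →
      σ' (ψ x) = ((Units.mapEquiv (ε : B ≃* B.map ψ) α : B.map ψ) : E') * ψ x := fun α hα => by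
    rw [hσ, hα, map_mul]
    rfl
  cases k with
  | root ν =>
    obtain ⟨hν, hker, α, hα, hσx⟩ := h
    refine ⟨hν, ?_, Units.mapEquiv (ε : B ≃* B.map ψ) α,
      hα.map_of_injective (Units.mapEquiv (ε : B ≃* B.map ψ)).injective, hunit α hσx⟩
    ext p'
    obtain ⟨p, rfl⟩ := (Polynomial.mapEquiv (ε : B ≃+* B.map ψ)).surjective p'
    have hev : aeval (ψ x) (Polynomial.mapEquiv (ε : B ≃+* B.map ψ) p) = ψ (aeval x p) := by
      rw [mapEquiv_apply, aeval_def, eval₂_map, aeval_def]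
      exact (hom_eval₂ p (algebraMap B E) (ψ : E →+* E') x).symm
    have hX : (X ^ ν - 1 : (B.map ψ)[X]) =
        Polynomial.mapEquiv (ε : B ≃+* B.map ψ) (X ^ ν - 1) := by simp
    rw [RingHom.mem_ker, Ideal.mem_span_singleton]
    change aeval (ψ x) _ = 0 ↔ _
    rw [hX, map_dvd_iff, ← Ideal.mem_span_singleton, ← hker, RingHom.mem_ker]
    change _ ↔ aeval x p = 0
    rw [hev, map_eq_zero_iff ψ hψ]
  | pi =>
    obtain ⟨hu, ht, α, hσx⟩ := h
    exact ⟨hu.map ψ, htr ht, Units.mapEquiv (ε : B ≃* B.map ψ) α, hunit α hσx⟩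
  | sigma =>
    obtain ⟨ht, hmem⟩ := h
    exact ⟨htr ht, by rw [hσ, ← map_sub]; exact ⟨_, hmem, rfl⟩⟩

theorem map_mem_level_of_generators {e e' : ℕ} {kind : Fin e → MonomialKind} {t : Fin e → E}
    {kind' : Fin e' → MonomialKind} {t' : Fin e' → E'} (ψ : E →ₐ[A] E')
    (hinv : ∀ y, ψ (Ring.inverse y) = Ring.inverse (ψ y))
    (hgen : ∀ j : Fin e, ∃ j' : Fin e', (j' : ℕ) = j ∧ kind' j' = kind j ∧ t' j' = ψ (t j))
    (O : Subring A) {i : ℕ} {y : E} (hy : y ∈ level O kind t i) : ψ y ∈ level O kind' t' i := by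
  induction hy using Algebra.adjoin_induction with
  | mem y hy =>
    obtain ⟨j, hj, hy⟩ := hy
    obtain ⟨j', hj', hk, ht⟩ := hgen j
    refine Algebra.subset_adjoin ⟨j', hj' ▸ hj, ?_⟩
    rcases hy with rfl | ⟨hkj, rfl⟩
    · exact Or.inl ht.symm
    · exact Or.inr ⟨hk.trans hkj, by rw [hinv, ht]⟩
  | algebraMap r =>
    change ψ (algebraMap A E r) ∈ _
    rw [ψ.commutes]
    exact Subalgebra.algebraMap_mem (level O kind' t' i) r
  | add x y _ _ hx hy => rw [map_add]; exact add_mem hx hy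
  | mul x y _ _ hx hy => rw [map_mul]; exact mul_mem hx hy

end Transfer

/-! ### A tower extended by one `Σ`-monomial -/

section Snoc

variable {A E : Type*} [CommRing A] [CommRing E] [Algebra A E] {e : ℕ}

/-- The kinds of a tower extended by a `Σ`-monomial. -/
abbrev snocKind (kind : Fin e → MonomialKind) : Fin (e + 1) → MonomialKind :=
  Fin.snoc kind MonomialKind.sigma

/-- The monomials of a tower extended by a polynomial variable. -/
abbrev snocMonomial (t : Fin e → E) : Fin (e + 1) → E[X] :=
  Fin.snoc (fun i => C (t i)) X

theorem snocKind_castSucc (kind : Fin e → MonomialKind) (j : Fin e) :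
    snocKind kind j.castSucc = kind j := Fin.snoc_castSucc (α := fun _ => MonomialKind) _ _ _

theorem snocKind_last (kind : Fin e → MonomialKind) : snocKind kind (Fin.last e) = .sigma :=
  Fin.snoc_last (α := fun _ => MonomialKind) _ _

theorem snocMonomial_castSucc (t : Fin e → E) (j : Fin e) :
    snocMonomial t j.castSucc = C (t j) := Fin.snoc_castSucc (α := fun _ => E[X]) _ _ _

theorem snocMonomial_last (t : Fin e → E) : snocMonomial t (Fin.last e) = X :=
  Fin.snoc_last (α := fun _ => E[X]) _ _

theorem C_inverse (a : E) : (C (Ring.inverse a) : E[X]) = Ring.inverse (C a) := by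
  by_cases ha : IsUnit a
  · obtain ⟨u, rfl⟩ := ha
    rw [Ring.inverse_unit]
    exact (Ring.inverse_unit (Units.map (C : E →+* E[X]).toMonoidHom u)).symm
  · rw [Ring.inverse_non_unit _ ha, Ring.inverse_non_unit _ (by rwa [isUnit_C]), C_0]

theorem C_ipow (a : E) (n : ℤ) : (C (ipow a n) : E[X]) = ipow (C a) n := by
  rw [ipow, ipow]
  split_ifs
  · rw [C_pow]
  · rw [C_pow, C_inverse]

theorem powerProduct_snoc (t : Fin e → E) (m : Fin e → ℤ) :
    powerProduct (snocMonomial t) (Fin.snoc m 0 : Fin (e + 1) → ℤ) = C (powerProduct t m) := by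
  rw [powerProduct, Fin.prod_univ_castSucc, powerProduct, map_prod]
  simp [C_ipow]

theorem level_snoc (kind : Fin e → MonomialKind) (t : Fin e → E) {i : ℕ} (hi : i ≤ e) :
    level A (snocKind kind) (snocMonomial t) i = (level A kind t i).map CAlgHom := by
  rw [level, level, AlgHom.map_adjoin]
  congr 1
  ext y
  constructor
  · rintro ⟨j, hj, hy⟩
    obtain ⟨j, rfl⟩ : ∃ j' : Fin e, j = j'.castSucc := ⟨⟨j, hj.trans_le hi⟩, rfl⟩
    rw [snocKind_castSucc, snocMonomial_castSucc] at hy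
    rcases hy with rfl | ⟨hk, rfl⟩
    · exact ⟨t j, ⟨j, hj, Or.inl rfl⟩, rfl⟩
    · exact ⟨_, ⟨j, hj, Or.inr ⟨hk, rfl⟩⟩, C_inverse _⟩
  · rintro ⟨_, ⟨j, hj, hy⟩, rfl⟩
    refine ⟨j.castSucc, hj, ?_⟩
    rw [snocKind_castSucc, snocMonomial_castSucc]
    rcases hy with rfl | ⟨hk, rfl⟩
    · exact Or.inl rfl
    · exact Or.inr ⟨hk, C_inverse _⟩

variable {kind : Fin e → MonomialKind} {t : Fin e → E} {σA : RingAut A} {σE : RingAut E}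
  {σ' : RingAut E[X]} {β : E}

/-- The first `e` levels are images of the old ones under `C`, so the old monomials transfer. Level
`e` is the ring of constant polynomials, over which `X` is a new `Σ`-monomial. -/
theorem IsRPiSigmaExt.snoc (h : IsRPiSigmaExt σA σE kind t) (hC : ∀ a, σ' (C a) = C (σE a))
    (hX : σ' X - X = C β) (hconst : ∀ y, σ' y = y → ∃ a, σE a = a ∧ C a = y) :
    IsRPiSigmaExt σA σ' (snocKind kind) (snocMonomial t) := by
  have hlevel : level A (snocKind kind) (snocMonomial t) e = (⊤ : Subalgebra A E).map CAlgHom := by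
    rw [level_snoc _ _ le_rfl, h.generates]
  have hCmem : ∀ a : E, (C a : E[X]) ∈ level A (snocKind kind) (snocMonomial t) e := fun a => by
    rw [hlevel]
    exact ⟨a, Algebra.mem_top, rfl⟩
  refine ⟨C_injective.comp h.injective, fun a => ?_, fun i => ?_, ?_, fun y hy => ?_⟩
  · rw [Polynomial.algebraMap_apply, hC, h.extends_base]
    rfl
  · refine Fin.lastCases ?_ (fun j => ?_) i
    · rw [snocKind_last, snocMonomial_last]
      change IsMonomial σ' (level A (snocKind kind) (snocMonomial t) e) X MonomialKind.sigma
      refine ⟨transcendental_X_of_range _ (fun b hb => ?_) hCmem, hX ▸ hCmem β⟩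
      rw [hlevel] at hb
      obtain ⟨a, -, ha⟩ := hb
      exact ⟨a, ha⟩
    · rw [snocKind_castSucc, snocMonomial_castSucc, Fin.val_castSucc, level_snoc _ _ j.2.le]
      exact (h.monomial j).map CAlgHom C_injective hC
  · rw [eq_top_iff]
    intro y _
    have hXmem : (X : E[X]) ∈ level A (snocKind kind) (snocMonomial t) (e + 1) := by
      have := monomial_mem_level (A := A) (kind := snocKind kind) (t := snocMonomial t)
        (j := Fin.last e) (i := e + 1) (by simp)
      rwa [snocMonomial_last] at this
    induction y using Polynomial.induction_on' with
    | add p q hp hq => exact add_mem (hp trivial) (hq trivial)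
    | monomial n a =>
      rw [← C_mul_X_pow_eq_monomial]
      exact mul_mem (level_mono (Nat.le_succ e) (hCmem a)) (pow_mem hXmem n)
  · obtain ⟨b, hb, rfl⟩ := hconst y hy
    obtain ⟨a, ha, rfl⟩ := h.constants_eq b hb
    exact ⟨a, ha, rfl⟩

theorem IsSimpleExt.snoc (h : IsSimpleExt A σE kind t) (hC : ∀ a, σ' (C a) = C (σE a)) :
    IsSimpleExt A σ' (snocKind kind) (snocMonomial t) := by
  have hm : ∀ (u : A) (m : Fin e → ℤ) (j : Fin e), σE (t j) = (u • powerProduct t m) * t j →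
      σ' (C (t j)) = (u • powerProduct (snocMonomial t) (Fin.snoc m 0 : Fin (e + 1) → ℤ)) *
        C (t j) := fun u m j hj => by
    rw [hC, hj, powerProduct_snoc, C_mul, smul_C]
  intro i
  refine Fin.lastCases ?_ (fun j => ?_) i
  · rw [snocKind_last]
    trivial
  · have hj := h j
    rw [snocKind_castSucc, snocMonomial_castSucc]
    rcases hk : kind j with ν | _ | _
    · rw [hk] at hj
      obtain ⟨u, m, hu, hmz, hσ⟩ := hj
      refine ⟨u, Fin.snoc m 0, hu, fun l => ?_, hm _ _ _ hσ⟩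
      refine Fin.lastCases (fun _ => by simp) (fun l hl => ?_) l
      rw [snocKind_castSucc] at hl
      simpa using hmz l (by simpa using hl)
    · rw [hk] at hj
      obtain ⟨u, m, hmz, hσ⟩ := hj
      refine ⟨u, Fin.snoc m 0, fun l => ?_, hm _ _ _ hσ⟩
      refine Fin.lastCases (fun _ => by simp) (fun l hl => ?_) l
      rw [snocKind_castSucc] at hl
      simpa using hmz l (by simpa using hl)
    · trivial

end Snoc

/-! ### The degree bound for the extended tower -/

section SnocDegree

variable {F : Type*} [Field F] {σ : RingAut (RatFunc F)} {E : Type*} [CommRing E]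
  [Algebra (RatFunc F) E] {σE : RingAut E} {e : ℕ} {kind : Fin e → MonomialKind} {t : Fin e → E}
  {d : ℕ} {σ' : RingAut E[X]} {β : E}

theorem IsSimpleRPiSigmaExtXDegreeLE.snoc (h : IsSimpleRPiSigmaExtXDegreeLE σ σE kind t d)
    (hC : ∀ a, σ' (C a) = C (σE a)) (hX : σ' X - X = C β)
    (hconst : ∀ y, σ' y = y → ∃ a, σE a = a ∧ C a = y)
    (hβ : ∀ p (hp : IsBad σ d p), β ∈ level (localRing p hp.irreducible) kind t e) :
    IsSimpleRPiSigmaExtXDegreeLE σ σ' (snocKind kind) (snocMonomial t) d := by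
  have hext := h.isExt.snoc hC hX hconst
  have hden : ∀ y : E,
      (∀ p (hp : IsBad σ d p), y ∈ level (localRing p hp.irreducible) kind t e) →
      XDegreeLE σ d (toRat (den F (snocKind kind) (snocMonomial t) (C y))) := fun y hy =>
    (hext.xDegreeLE_den_iff (hext.mem_level_length _)).2 fun p hp =>
      level_mono (Nat.le_succ e) (map_mem_level_of_generators CAlgHom C_inverse
        (fun j => ⟨j.castSucc, rfl, snocKind_castSucc _ _, snocMonomial_castSucc _ _⟩) _ (hy p hp))
  refine ⟨hext, h.simple.snoc hC, fun i => ?_⟩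
  refine Fin.lastCases ?_ (fun j => ?_) i
  · rw [snocKind_last, snocMonomial_last, hX]
    exact hden β hβ
  · have hj := h.xDegreeLE j
    rw [snocKind_castSucc, snocMonomial_castSucc]
    rcases hk : kind j with ν | _ | _
    · trivial
    · rw [hk] at hj
      obtain ⟨u, m, hu, hud, hmz, hσ⟩ := hj
      refine ⟨u, Fin.snoc m 0, hu, hud, fun l => ?_, ?_⟩
      · refine Fin.lastCases (fun _ => by simp) (fun l hl => ?_) l
        rw [snocKind_castSucc] at hl
        simpa using hmz l (by simpa using hl)
      · rw [hC, hσ, powerProduct_snoc, C_mul, smul_C]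
    · rw [hk] at hj
      change XDegreeLE σ d (toRat (den F _ _ _))
      rw [hC, ← C_sub]
      exact hden _ ((h.isExt.xDegreeLE_den_iff (h.isExt.mem_level_length _)).1 hj)

end SnocDegree

/-! ### Linear combinations of reduced forms -/

section ReducedForms

variable {F : Type*} [Field F] {σF : RingAut F} {σ : RingAut (RatFunc F)} {E : Type*} [CommRing E]
  [Algebra (RatFunc F) E] {σE : RingAut E} {e : ℕ} {kind : Fin e → MonomialKind} {t : Fin e → E}
  {d : ℕ}

/-- All coefficients are polynomials of degree `< k` in `x`. -/
def HasCoeffsInDegreeLT (F : Type*) [Field F] {E : Type*} [CommRing E] [Algebra (RatFunc F) E]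
    {e : ℕ} (kind : Fin e → MonomialKind) (t : Fin e → E) (k : ℕ) (y : E) : Prop :=
  ∀ n, ∃ a ∈ degreeLT F k, coeffs (RatFunc F) kind t y n = toRat a

theorem hasCoeffsInDegreeLT_iff {k : ℕ} {y : E} :
    HasCoeffsInDegreeLT F kind t k y ↔ IsXPoly F kind t y ∧ degX F kind t y < (k : WithBot ℕ) := by
  constructor
  · intro h
    refine ⟨fun n => (h n).imp fun a ha => ha.2, ?_⟩
    refine (Finset.sup_lt_iff (WithBot.bot_lt_coe k)).2 fun n _ => ?_
    obtain ⟨a, ha, hna⟩ := h n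
    rw [hna, RatFunc.num_algebraMap]
    exact mem_degreeLT.1 ha
  · rintro ⟨h, hdeg⟩ n
    obtain ⟨a, ha⟩ := h n
    by_cases hn : n ∈ (coeffs (RatFunc F) kind t y).support
    · have hle := Finset.le_sup (f := fun n => (coeffs (RatFunc F) kind t y n).num.degree) hn
      simp only [ha, RatFunc.num_algebraMap] at hle
      exact ⟨a, mem_degreeLT.2 (hle.trans_lt hdeg), ha⟩
    · exact ⟨0, zero_mem _, by rw [Finsupp.notMem_support_iff.1 hn, toRat, map_zero]⟩

theorem HasCoeffsInDegreeLT.toRat_smul (h : IsRPiSigmaExt σ σE kind t) {k : ℕ} {y : E}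
    (hy : HasCoeffsInDegreeLT F kind t k y) {b : F[X]} {l : ℕ}
    (hb : b.natDegree + k ≤ l) : HasCoeffsInDegreeLT F kind t l (toRat b • y) := by
  intro n
  obtain ⟨a, ha, hna⟩ := hy n
  refine ⟨b * a, ?_, ?_⟩
  · rcases eq_or_ne a 0 with rfl | ha0
    · simp
    rcases eq_or_ne b 0 with rfl | hb0
    · simp
    rw [mem_degreeLT] at ha ⊢
    rw [← natDegree_lt_iff_degree_lt ha0] at ha
    rw [← natDegree_lt_iff_degree_lt (mul_ne_zero hb0 ha0), natDegree_mul hb0 ha0]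
    omega
  · rw [toRat_mul, ← hna]
    exact DFunLike.congr_fun (h.coeffsLinear.map_smul (toRat b) y) n

theorem HasCoeffsInDegreeLT.sum (h : IsRPiSigmaExt σ σE kind t) {k : ℕ} {ι : Type*}
    {s : Finset ι} {y : ι → E} (hy : ∀ i ∈ s, HasCoeffsInDegreeLT F kind t k (y i)) :
    HasCoeffsInDegreeLT F kind t k (∑ i ∈ s, y i) := by
  intro n
  have hsum : coeffs (RatFunc F) kind t (∑ i ∈ s, y i) n =
      ∑ i ∈ s, coeffs (RatFunc F) kind t (y i) n := by
    have := DFunLike.congr_fun (map_sum h.coeffsLinear y s) n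
    rw [Finsupp.finsetSum_apply] at this
    exact this
  choose! a ha hna using fun i (hi : i ∈ s) => hy i hi n
  refine ⟨∑ i ∈ s, a i, sum_mem ha, ?_⟩
  rw [hsum, toRat, map_sum]
  exact Finset.sum_congr rfl hna

/-- Constants of `E` come from `F`, so multiplying by them creates no poles and does not raise
degrees in `x`. -/
theorem exists_base_constant (hσ : IsPiSigmaFieldExt σF σ) (h : IsRPiSigmaExt σ σE kind t)
    (c : constants σE) : ∃ a : F, algebraMap (RatFunc F) E (RatFunc.C a) = c := by
  obtain ⟨y, hy, hyc⟩ := h.constants_eq c c.2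
  obtain ⟨a, -, rfl⟩ := hσ.constants_eq y hy
  exact ⟨a, hyc⟩

theorem quot_mul_pow_sub (y : E) {b : F[X]} (hb : b ≠ 0) {k l : ℕ} (hkl : k ≤ l) :
    quot (toRat (b ^ (l - k)) • y) (b ^ l) = quot y (b ^ k) := by
  rw [quot, quot, smul_smul]
  congr 1
  have hb' : toRat b ≠ 0 := fun h => hb (toRat_injective (h.trans (map_zero _).symm))
  have hp : ∀ k, toRat (b ^ k) = toRat b ^ k := fun k => map_pow _ b k
  rw [hp, hp, hp, inv_mul_eq_div, div_eq_iff (pow_ne_zero _ hb'), pow_sub₀ _ hb' hkl, mul_comm]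

theorem mul_quot (c y : E) (b : F[X]) : c * quot y b = quot (c * y) b :=
  mul_smul_comm _ _ _

theorem quot_sum {ι : Type*} (s : Finset ι) (y : ι → E) (b : F[X]) :
    ∑ i ∈ s, quot (y i) b = quot (∑ i ∈ s, y i) b := Finset.smul_sum.symm

variable {m r : ℕ} {q : Fin r → F[X]} {f' : Fin m → E} {P : Fin m → Fin r → E}
  {n : Fin m → Fin r → ℕ} {p' : Fin m → E} {q' : Fin m → F[X]}

/-- The numerator over `q_j ^ μ_j` of the linear combination of reduced forms. -/
def combinedNumerator (σE : RingAut E) (q : Fin r → F[X]) (P : Fin m → Fin r → E)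
    (n : Fin m → Fin r → ℕ) (c : Fin m → constants σE) (j : Fin r) : E :=
  ∑ i, (c i : E) * toRat (q j ^ ((Finset.univ.sup fun k => n k j) - n i j)) • P i j

theorem mem_annSpace_iff {c : Fin m → constants σE} {j : Fin r} :
    c ∈ annSpace σE q P n j ↔ combinedNumerator σE q P n c j = 0 := mem_Ann _ _ _

theorem sum_mul_reducedForm (hq : ∀ j, q j ≠ 0)
    (hf' : ∀ i, IsReducedForm σ kind t d q (f' i) (P i) (n i) (p' i) (q' i))
    (c : Fin m → constants σE) :
    ∑ i, (c i : E) * f' i =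
      (∑ j, quot (combinedNumerator σE q P n c j) (q j ^ Finset.univ.sup fun k => n k j)) +
        ∑ i, (c i : E) * quot (p' i) (q' i) := by
  simp only [combinedNumerator, ← quot_sum]
  rw [Finset.sum_comm, ← Finset.sum_add_distrib]
  refine Finset.sum_congr rfl fun i _ => ?_
  rw [(hf' i).eq_sum, mul_add, Finset.mul_sum]
  congr 1
  refine Finset.sum_congr rfl fun j _ => ?_
  rw [← mul_quot, quot_mul_pow_sub _ (hq j)
    (Finset.le_sup (f := fun k => n k j) (Finset.mem_univ i))]

theorem combinedNumerator_hasCoeffs (hσ : IsPiSigmaFieldExt σF σ)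
    (h : IsRPiSigmaExt σ σE kind t)
    (hf' : ∀ i, IsReducedForm σ kind t d q (f' i) (P i) (n i) (p' i) (q' i))
    (c : Fin m → constants σE) (j : Fin r) :
    HasCoeffsInDegreeLT F kind t ((q j).natDegree * Finset.univ.sup fun k => n k j)
      (combinedNumerator σE q P n c j) := by
  refine HasCoeffsInDegreeLT.sum h fun i _ => ?_
  obtain ⟨a, ha⟩ := exists_base_constant hσ h (c i)
  have hP := hasCoeffsInDegreeLT_iff.2 ⟨(hf' i).isXPoly_bad j, (hf' i).degX_lt j⟩
  have hle := Finset.le_sup (f := fun k => n k j) (Finset.mem_univ i)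
  rw [← ha, ← Algebra.smul_def, show RatFunc.C a = toRat (C a) by simp]
  refine (hP.toRat_smul h (l := (q j).natDegree * Finset.univ.sup fun k => n k j) ?_).toRat_smul h
    (by simp)
  -- The factor `q_j ^ (μ_j - n_{i,j})` raises the bound `n_{i,j} deg q_j` to exactly `μ_j deg q_j`,
  -- so the combined fraction stays proper.
  rw [natDegree_pow, mul_comm, ← mul_add, Nat.sub_add_cancel hle]

theorem sum_mul_quot_mem_level (hσ : IsPiSigmaFieldExt σF σ) (h : IsRPiSigmaExt σ σE kind t)
    (hf' : ∀ i, IsReducedForm σ kind t d q (f' i) (P i) (n i) (p' i) (q' i))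
    (c : Fin m → constants σE) {p : F[X]} (hp : IsBad σ d p) :
    ∑ i, (c i : E) * quot (p' i) (q' i) ∈ level (localRing p hp.irreducible) kind t e := by
  refine sum_mem fun i _ => ?_
  obtain ⟨a, ha⟩ := exists_base_constant hσ h (c i)
  rw [← ha, ← Algebra.smul_def]
  exact Subalgebra.smul_mem (level (localRing p hp.irreducible) kind t e)
    ((hf' i).isXPoly.quot_mem_level h hp.irreducible
      (xDegreeLE_toRat_iff.1 (hf' i).xDegreeLE p hp))
    (⟨_, C_mem_localRing hp.irreducible a⟩ : localRing p hp.irreducible)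

end ReducedForms

end RefinedTelescoping

end

/-! ### The refined telescoping theorem -/

open RefinedTelescoping in
theorem mainTheorem5 {F : Type*} [Field F] [CharZero F] (σF : RingAut F)
    (σ : RingAut (RatFunc F)) (hσ : IsPiSigmaFieldExt σF σ)
    {E : Type*} [CommRing E] [Algebra (RatFunc F) E] (σE : RingAut E)
    {e : ℕ} (kind : Fin e → MonomialKind) (t : Fin e → E) (d : ℕ)
    (hE : IsSimpleRPiSigmaExtXDegreeLE σ σE kind t d)
    {m r : ℕ} (f : Fin m → E)
    (q : Fin r → F[X]) (hq : Function.Injective q) (hQ : IsDXSet σ d (Set.range q))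
    (hcomplete : ∀ i, IsComplete σ d (den F kind t (f i)) (Set.range q))
    (f' g : Fin m → E) (hg : ∀ i, σE (g i) - g i + f' i = f i)
    (P : Fin m → Fin r → E) (n : Fin m → Fin r → ℕ) (p' : Fin m → E) (q' : Fin m → F[X])
    (hf' : ∀ i, IsReducedForm σ kind t d q (f' i) (P i) (n i) (p' i) (q' i))
    (c : Fin m → constants σE) :
    ((∃ h : E, σE h - h = ∑ i, (c i : E) * f i) ↔
      (∃ g' : E, σE g' - g' = ∑ i, (c i : E) * quot (p' i) (q' i)) ∧
        ∀ j, c ∈ annSpace σE q P n j) ∧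
    (∀ g' : E, σE g' - g' = ∑ i, (c i : E) * quot (p' i) (q' i) →
      (∀ j, c ∈ annSpace σE q P n j) →
        XDegreeLE σ d (toRat (den F kind t g')) ∧
        σE (g' + ∑ i, (c i : E) * g i) - (g' + ∑ i, (c i : E) * g i) = ∑ i, (c i : E) * f i) ∧
    ((∀ j, c ∈ annSpace σE q P n j) →
      (¬ ∃ g' : E, σE g' - g' = ∑ i, (c i : E) * quot (p' i) (q' i)) →
        ∃ σ' : RingAut E[X],
          σ' X - X = C (∑ i, (c i : E) * quot (p' i) (q' i)) ∧
          IsRPiSigmaExt σE σ' (fun _ : Fin 1 => MonomialKind.sigma) (fun _ => (X : E[X])) ∧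
          IsSimpleRPiSigmaExtXDegreeLE σ σ'
            (Fin.snoc kind MonomialKind.sigma : Fin (e + 1) → MonomialKind)
            (Fin.snoc (fun i => C (t i)) X : Fin (e + 1) → E[X]) d ∧
          σ' (X + C (∑ i, (c i : E) * g i)) - (X + C (∑ i, (c i : E) * g i)) =
            C (∑ i, (c i : E) * f i)) := by
  have hq0 : ∀ j, q j ≠ 0 := fun j => (hQ.irreducible _ ⟨j, rfl⟩).ne_zero
  have hcf := sum_mul_reducedForm (σE := σE) hq0 hf' c
  have hβ : ∀ p (hp : IsBad σ d p), ∑ i, (c i : E) * quot (p' i) (q' i) ∈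
      level (localRing p hp.irreducible) kind t e :=
    fun p hp => sum_mul_quot_mem_level hσ hE.isExt hf' c hp
  have hG : σE (∑ i, (c i : E) * g i) - ∑ i, (c i : E) * g i + ∑ i, (c i : E) * f' i =
      ∑ i, (c i : E) * f i := by
    rw [map_sum, ← Finset.sum_sub_distrib, ← Finset.sum_add_distrib]
    refine Finset.sum_congr rfl fun i _ => ?_
    have hc : σE (c i : E) = c i := (c i).2
    rw [map_mul, hc, ← hg i]
    ring
  have hann : (∀ j, c ∈ annSpace σE q P n j) →
      ∑ i, (c i : E) * f' i = ∑ i, (c i : E) * quot (p' i) (q' i) := fun hc => by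
    rw [hcf, Finset.sum_eq_zero, zero_add]
    intro j _
    rw [mem_annSpace_iff.1 (hc j), quot, smul_zero]
  refine ⟨⟨?_, ?_⟩, ?_, ?_⟩
  · rintro ⟨h, hh⟩
    have hg' : σE (h - ∑ i, (c i : E) * g i) - (h - ∑ i, (c i : E) * g i) =
        ∑ i, (c i : E) * f' i := by
      rw [map_sub]
      linear_combination hh - hG
    have hN := fun j => hasCoeffsInDegreeLT_iff.1
      (combinedNumerator_hasCoeffs hσ hE.isExt hf' c j)
    have hc : ∀ j, c ∈ annSpace σE q P n j := fun j => mem_annSpace_iff.2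
      (hE.numerators_eq_zero hσ hq hQ (fun j => (hN j).1) (fun j => (hN j).2) hβ
        (hg'.trans hcf) j)
    exact ⟨⟨_, hg'.trans (hann hc)⟩, hc⟩
  · rintro ⟨⟨g', hg'⟩, hc⟩
    refine ⟨g' + ∑ i, (c i : E) * g i, ?_⟩
    rw [map_add]
    linear_combination hg' + hG - hann hc
  · intro g' hg' hc
    -- The right-hand side has no bad poles at all, so the pole argument applies with the empty set.
    refine ⟨(hE.isExt.xDegreeLE_den_iff (hE.isExt.mem_level_length g')).2 fun p hp =>
      hE.mem_level_of_telescoping hσ (T := ∅) (by simp) (by simp)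
        (fun p hp hnot => absurd (hg' ▸ hβ p hp) hnot) hp, ?_⟩
    rw [map_add]
    linear_combination hg' + hG - hann hc
  · intro hc hno
    have : CharZero (RatFunc F) := charZero_of_injective_algebraMap (RatFunc.C_injective (K := F))
    set β : E := ∑ i, (c i : E) * quot (p' i) (q' i)
    have hX : sigmaAut σE β X - X = C β := by rw [sigmaAut_X, add_sub_cancel_left]
    have hconst : ∀ y, sigmaAut σE β y = y → ∃ a, σE a = a ∧ C a = y := fun y hy =>
      sigmaAut_constants hE.isExt.extends_base hE.isExt.constants_eq hno hy
    refine ⟨sigmaAut σE β, hX, isRPiSigmaExt_polynomial (sigmaAut_C σE β) hX hconst,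
      hE.snoc (sigmaAut_C σE β) hX hconst hβ, ?_⟩
    rw [map_add, sigmaAut_X, sigmaAut_C, ← hG, hann hc]
    simp only [C_add, C_sub]
    ring
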